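/- **Learning guarantee of the RLDAM-based algorithm in batch multi-label learning.** Setting. Let $P$ be a probability distribution on $\mathcal X\times\{0,1\}^K$ with $0<P(y_k=1)<1$ for every label $k\in[K]$, and put $P_k^+=P(x\mid y_k=1)$, $P_k^-=P(x\mid y_k=0)$. Let $\kappa:\mathcal X\times\mathcal X\to\mathbb R$ be a (measurable) positive definite symmetric kernel with $\kappa(x,x)\le r^2$ for all $x$, where $r>0$, and let $\Phi:\mathcal X\to\mathbb H$ be a feature map of $\kappa$ into a real Hilbert space, i.e. $\langle\Phi(x),\Phi(x')\rangle=\kappa(x,x')$ (for instance the canonical map into the RKHS of $\kappa$). The hypothesis class is $$\mathcal F=\{x\mapsto(\langle w_1,\Phi(x)\rangle,\dots,\langle w_K,\Phi(x)\rangle):\ \|w_k\|_{\mathbb H}\le\Lambda\ \text{for all }k\}.$$ Losses. Let $\ell(z)=\max(0,1-z)$ be the hinge loss and let $\Delta_k^+,\Delta_k^->0$ be margins. Assume that the base loss is bounded by $B$ on the values that occur, i.e. $\ell(f_k(x)-\Delta_k^+)\le B$ and $\ell(-f_k(x)-\Delta_k^-)\le B$ for all $f\in\mathcal F$, $x\in\mathcal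 X$, $k\in[K]$, and that $z\mapsto\ell(z-\Delta_k^+)$ and $z\mapsto\ell(z-\Delta_k^-)$ are $\rho_k^+$- and $\rho_k^-$-Lipschitz on $\mathbb R$ (e.g. $\rho_k^\pm=1/\Delta_k^\pm$ when $\Delta_k^\pm\le 1$). For a positive instance $x^+$ and a negative instance $x^-$ of label $k$ put $$\mathcal L_{\mathrm{RM}}(x^+,x^-,f_k)=\ell(f_k(x^+)-\Delta_k^+)+\ell(-f_k(x^-)-\Delta_k^-),\qquad \mathcal L_{0/1}(x^+,x^-,f_k)=[\![f_k(x^+)\le f_k(x^-)]\!].$$ Risks. Define $$R^{0/1}(f)=\frac1K\sum_{k=1}^K\mathop{\mathbb E}_{x_p\sim P_k^+,\,x_q\sim P_k^-}\mathcal L_{0/1}(x_p,x_q,f_k),\qquad R^{\mathrm{RM}}(f)=\frac1K\sum_{k=1}^K\mathop{\mathbb E}_{x_p\sim P_k^+,\,x_q\sim P_k^-}\mathcal L_{\mathrm{RM}}(x_p,x_q,f_k),$$ with $x_p,x_q$ independent. For a sample $\mathbb D=\{(x_i,y_i)\}_{i=1}^n$ let $\mathbb D_k^+$, $\mathbb D_k^-$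 be the sets of indices $i$ with $y_{ik}=1$, $y_{ik}=0$, let $\tau_k=\min(|\mathbb D_k^+|,|\mathbb D_k^-|)/n$, and let $$\widehat R^{\mathrm{RM}}_{\mathbb D}(f)=\frac1K\sum_{k=1}^K\frac1{|\mathbb D_k^+||\mathbb D_k^-|}\sum_{(p,q)\in\mathbb D_k^+\times\mathbb D_k^-}\mathcal L_{\mathrm{RM}}(x_p,x_q,f_k).$$ Theorem. For every $f\in\mathcal F$, $R^{0/1}(f)\le R^{\mathrm{RM}}(f)$. Moreover, for every $\delta>0$, with probability at least $1-\delta$ over the draw of an i.i.d. sample $\mathbb D$ of size $n$ from $P$, the following holds simultaneously for all $f\in\mathcal F$ (the right-hand side being read as $+\infty$ when some $\mathbb D_k^\pm$ is empty, i.e. some $\tau_k=0$): $$R^{\mathrm{RM}}(f)\le\widehat R^{\mathrm{RM}}_{\mathbb D}(f)+\frac{4\Lambda r}{\sqrt n}\Big(\frac1K\sum_{k=1}^K\sqrt{\frac1{\tau_k}}\,(\rho_k^++\rho_k^-)\Big)+6B\sqrt{\frac{\log(2/\delta)}{2n}}\,\sqrt{\frac1K\sum_{k=1}^K\frac1{\tau_k}}.$$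 -/

import Mathlib

open MeasureTheory ProbabilityTheory
open scoped NNReal ENNReal

noncomputable section

namespace MacroAUC

/-- A multi-label example `(x, y)` with `y ∈ {0,1}^K`; `true` encodes `1` (relevant label). -/
abbrev Example (X : Type*) (K : ℕ) : Type _ := X × (Fin K → Bool)

/-- A data set of `n` multi-label examples. -/
abbrev Dataset (X : Type*) (K n : ℕ) : Type _ := Fin n → Example X K

/-- The indices of the positive instances of the label `k`. -/
def posIdx {X : Type*} {K n : ℕ} (D : Dataset X K n) (k : Fin K) : Finset (Fin n) :=
  Finset.univ.filter fun i => (D i).2 k = true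

/-- The indices of the negative instances of the label `k`. -/
def negIdx {X : Type*} {K n : ℕ} (D : Dataset X K n) (k : Fin K) : Finset (Fin n) :=
  Finset.univ.filter fun i => (D i).2 k = false

/-- The label-wise class imbalance `τ_k = min (|D_k⁺|, |D_k⁻|) / n`. -/
def imbalance {X : Type*} {K n : ℕ} (D : Dataset X K n) (k : Fin K) : ℝ :=
  (min (posIdx D k).card (negIdx D k).card : ℝ) / n

/-- The hinge loss `ℓ(z) = max (0, 1 - z)`. -/
def hinge (z : ℝ) : ℝ := max 0 (1 - z)

/-- The reweighted label-distribution-aware margin loss of a scoring function `g` (one label) with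
margins `Δp`, `Δm` on a positive instance `xp` and a negative instance `xm`. -/
def lossRM {X : Type*} (Δp Δm : ℝ) (xp xm : X) (g : X → ℝ) : ℝ :=
  hinge (g xp - Δp) + hinge (-g xm - Δm)

open Classical in
/-- The pairwise 0/1 loss `⟦g(xp) ≤ g(xm)⟧`. -/
def loss01 {X : Type*} (xp xm : X) (g : X → ℝ) : ℝ := if g xp ≤ g xm then 1 else 0

/-- `P_k⁺ = P(x | y_k = 1)`. -/
def posLaw {X : Type*} [MeasurableSpace X] {K : ℕ} (P : Measure (Example X K)) (k : Fin K) :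
    Measure X :=
  (P[|{z | z.2 k = true}]).map Prod.fst

/-- `P_k⁻ = P(x | y_k = 0)`. -/
def negLaw {X : Type*} [MeasurableSpace X] {K : ℕ} (P : Measure (Example X K)) (k : Fin K) :
    Measure X :=
  (P[|{z | z.2 k = false}]).map Prod.fst

/-- The expected 0/1 risk (one minus the expected Macro-AUC). -/
def risk01 {X : Type*} [MeasurableSpace X] {K : ℕ} (P : Measure (Example X K))
    (f : X → Fin K → ℝ) : ℝ :=
  (1 / (K : ℝ)) * ∑ k, ∫ z, loss01 z.1 z.2 (fun x => f x k) ∂((posLaw P k).prod (negLaw P k))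

/-- The expected risk with respect to the loss `lossRM`. -/
def riskRM {X : Type*} [MeasurableSpace X] {K : ℕ} (P : Measure (Example X K))
    (Δp Δm : Fin K → ℝ) (f : X → Fin K → ℝ) : ℝ :=
  (1 / (K : ℝ)) * ∑ k, ∫ z, lossRM (Δp k) (Δm k) z.1 z.2 (fun x => f x k)
    ∂((posLaw P k).prod (negLaw P k))

/-- The empirical risk with respect to the loss `lossRM`. It is meaningful when every label has
a positive and a negative instance in `D`. -/
def empRiskRM {X : Type*} {K n : ℕ} (D : Dataset X K n) (Δp Δm : Fin K → ℝ)
    (f : X → Fin K → ℝ) : ℝ :=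
  (1 / (K : ℝ)) * ∑ k, (1 / (((posIdx D k).card : ℝ) * ((negIdx D k).card : ℝ))) *
    ∑ pq ∈ posIdx D k ×ˢ negIdx D k,
      lossRM (Δp k) (Δm k) (D pq.1).1 (D pq.2).1 (fun x => f x k)

/-- The kernel hypothesis class: all `x ↦ (⟪w_k, Φ(x)⟫)_k` with `‖w_k‖ ≤ Λ` for every `k`. -/
def kernelClass {X H : Type*} [NormedAddCommGroup H] [InnerProductSpace ℝ H] (K : ℕ)
    (Φ : X → H) (Λ : ℝ) : Set (X → Fin K → ℝ) :=
  {f | ∃ w : Fin K → H, (∀ k, ‖w k‖ ≤ Λ) ∧ ∀ x k, f x k = inner ℝ (w k) (Φ x)}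

end MacroAUC

end

/-!
The surrogate loss of a pair is a sum of a loss of the positive and a loss of the negative instance,
so for one label `k` both the expected and the empirical risk are sums over the two classes, and no
pairs remain. The inequality between the two risks holds pointwise (`loss01_le_lossRM`).

For the deviation bound, fix a label `k` and condition on its values in the sample. The instances
are then independent with the laws `P_k⁺` and `P_k⁻` (`measurePreserving_instances`), and the usual
argument applies: the uniform deviation over the ball is at most its mean, which is controlled by
symmetrization (`integral_ghostSup_le`) and the contraction principle
(`sum_signs_iSup_le_of_lipschitz`), plus a fluctuation that is sub-Gaussian by McDiarmid's
inequality (`hasSubgaussianMGF_of_bounded_differences`). Conditioning on all labels at once would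
not do, since given the whole label vector an instance no longer has the law `P_k⁺` or `P_k⁻`.

The labels are put together without a union bound. The fluctuation of the label `k`, rescaled by the
conditional class sizes, is a variable `Z k` whose square has exponential moment at most `2`
(`lintegral_exp_mul_sq_le_two`), and this survives averaging over the values of the label
(`exists_deviation_of_label`). By Jensen's and Markov's inequalities the average of the squares
`Z k ^ 2` is at most `log (2 / δ)` with probability at least `1 - δ`
(`exists_event_average_sq_le`), whatever the dependence between the labels, and the Cauchy–Schwarz
inequality separates the `Z k` from the random class sizes (`average_div_sqrt_mul_le`).

The supremum over the ball is uncountable and `Φ` is only weakly measurable. A supremum that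
involves finitely many instances reduces to a countable one (`ballSup_eq_iSup_denseSeq`). The
expected risk is not of this form, so the deviation is first bounded by the mean, over a ghost
sample, of a supremum that is (`exists_hasSubgaussianMGF_uniform_deviation`).
-/

namespace MacroAUC

/-! ### Concentration -/

/-- The coordinates are changed one at a time; in particular `g` is bounded. -/
lemma abs_sub_le_sum_of_bounded_differences {X : Type*} {n : ℕ} {g : (Fin n → X) → ℝ}
    {c : Fin n → ℝ} (hg : ∀ i x y, (∀ j, j ≠ i → x j = y j) → |g x - g y| ≤ c i)
    (x y : Fin n → X) : |g x - g y| ≤ ∑ i, c i := by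
  induction n with
  | zero => simp [Subsingleton.elim x y]
  | succ n ih =>
    have h1 : |g x - g (Fin.cons (x 0) (Fin.tail y))| ≤ ∑ i : Fin n, c i.succ := by
      have := ih (g := fun z => g (Fin.cons (x 0) z)) (c := fun i => c i.succ)
        (fun i u v huv => hg i.succ _ _ fun j hj => by
          refine Fin.cases (by simp) (fun j hj => ?_) j hj
          simpa using huv j (by simpa using hj)) (Fin.tail x) (Fin.tail y)
      simpa using this
    have h2 : |g (Fin.cons (x 0) (Fin.tail y)) - g y| ≤ c 0 :=
      hg 0 _ _ fun j hj => by
        obtain ⟨j, rfl⟩ := Fin.exists_succ_eq.2 hj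
        simp [Fin.tail]
    rw [Fin.sum_univ_succ]
    calc _ ≤ _ := abs_sub_le _ (g (Fin.cons (x 0) (Fin.tail y))) _
      _ ≤ _ := by linarith

/-- The mgf bound behind **McDiarmid's inequality**. The variables are integrated out one at a
time; the conditional fluctuation in each of them is controlled by Hoeffding's lemma. -/
lemma mgf_le_of_bounded_differences {X : Type*} [MeasurableSpace X] {n : ℕ}
    (μ : Fin n → Measure X) [∀ i, IsProbabilityMeasure (μ i)] {g : (Fin n → X) → ℝ}
    (hgm : Measurable g) {c : Fin n → ℝ}
    (hg : ∀ i x y, (∀ j, j ≠ i → x j = y j) → |g x - g y| ≤ c i) (t : ℝ) :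
    ∫ x, Real.exp (t * (g x - ∫ y, g y ∂Measure.pi μ)) ∂Measure.pi μ
      ≤ Real.exp ((∑ i, c i ^ 2) * t ^ 2 / 8) := by
  induction n with
  | zero =>
    have : ∀ x : Fin 0 → X, g x = g default := fun x => by rw [Subsingleton.elim x default]
    simp [this]
  | succ n ih =>
    have : Nonempty X := (μ 0).nonempty_of_neZero
    obtain ⟨x₀⟩ : Nonempty (Fin (n + 1) → X) := ⟨fun _ => Classical.arbitrary X⟩
    set M : ℝ := |g x₀| + ∑ i, c i
    have hbd : ∀ x, |g x| ≤ M := fun x => by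
      have h1 := abs_sub_le_sum_of_bounded_differences hg x x₀
      have h2 := abs_add_le (g x - g x₀) (g x₀)
      rw [sub_add_cancel] at h2
      linarith
    have hcons : Measurable fun p : X × (Fin n → X) => (Fin.cons p.1 p.2 : Fin (n + 1) → X) := by
      refine measurable_pi_lambda _ fun i => ?_
      refine Fin.cases ?_ (fun i => ?_) i
      · simpa using measurable_fst
      · simp only [Fin.cons_succ]
        exact (measurable_pi_apply i).comp measurable_snd
    set ν : Measure (Fin n → X) := Measure.pi fun i : Fin n => μ i.succ with hν
    have hmp : MeasurePreserving (fun p : X × (Fin n → X) => (Fin.cons p.1 p.2 : Fin (n + 1) → X))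
        ((μ 0).prod ν) (Measure.pi μ) := by
      have := (measurePreserving_piFinSuccAbove μ 0).symm
      convert this using 1
      · funext p
        simp [MeasurableEquiv.piFinSuccAbove, Fin.insertNthEquiv]
      · simp [hν]
    have hfub : ∀ F : (Fin (n + 1) → X) → ℝ, Measurable F → (∃ C, ∀ x, |F x| ≤ C) →
        ∫ x, F x ∂Measure.pi μ = ∫ z, ∫ a, F (Fin.cons a z) ∂(μ 0) ∂ν := by
      rintro F hF ⟨C, hC⟩
      rw [← hmp.map_eq, integral_map hcons.aemeasurable hF.aestronglyMeasurable]
      refine integral_prod_symm _ ?_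
      exact Integrable.of_bound (hF.comp hcons).aestronglyMeasurable C
        (Filter.Eventually.of_forall fun p => hC _)
    set g₁ : (Fin n → X) → ℝ := fun z => ∫ a, g (Fin.cons a z) ∂(μ 0)
    have hg₁m : Measurable g₁ := by
      have : StronglyMeasurable fun p : (Fin n → X) × X => g (Fin.cons p.2 p.1) :=
        (hgm.comp (hcons.comp measurable_swap)).stronglyMeasurable
      exact this.integral_prod_right.measurable
    have hsec : ∀ z, Measurable fun a => g (Fin.cons a z) := fun z =>
      hgm.comp (hcons.comp (measurable_id.prodMk measurable_const))
    have hint : ∀ z, Integrable (fun a => g (Fin.cons a z)) (μ 0) := fun z =>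
      Integrable.of_bound (hsec z).aestronglyMeasurable M
        (Filter.Eventually.of_forall fun p => hbd _)
    have hg₁d : ∀ i x y, (∀ j, j ≠ i → x j = y j) → |g₁ x - g₁ y| ≤ c i.succ := by
      intro i x y hxy
      simp only [g₁]
      rw [← integral_sub (hint x) (hint y)]
      have := norm_integral_le_of_norm_le_const (μ := μ 0) (C := c i.succ)
        (f := fun a => g (Fin.cons a x) - g (Fin.cons a y))
        (Filter.Eventually.of_forall fun a => hg i.succ _ _ fun j hj => by
          refine Fin.cases (by simp) (fun j hj => ?_) j hj
          simpa using hxy j (by simpa using hj))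
      simpa using this
    have hm : ∫ y, g y ∂Measure.pi μ = ∫ z, g₁ z ∂ν := hfub g hgm ⟨M, hbd⟩
    have hg₁b : ∀ z, |g₁ z| ≤ M := fun z => by
      simpa using norm_integral_le_of_norm_le_const (μ := μ 0) (C := M)
        (f := fun a => g (Fin.cons a z)) (Filter.Eventually.of_forall fun a => hbd _)
    rw [hm]
    set m := ∫ z, g₁ z ∂ν
    have hexpb : ∀ u, |u| ≤ M → ‖Real.exp (t * (u - m))‖ ≤ Real.exp (|t| * (M + |m|)) := by
      intro u hu
      rw [Real.norm_eq_abs, abs_of_pos (Real.exp_pos _), Real.exp_le_exp]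
      calc t * (u - m) ≤ |t * (u - m)| := le_abs_self _
        _ = |t| * |u - m| := abs_mul _ _
        _ ≤ _ := by gcongr; exact (abs_sub _ _).trans (by linarith)
    rw [hfub (fun x => Real.exp (t * (g x - m))) (by fun_prop) ⟨_, fun x => hexpb _ (hbd x)⟩]
    -- Hoeffding's lemma on the range of `g` in its first variable, which has length at most `c 0`.
    have hinner : ∀ z, ∫ a, Real.exp (t * (g (Fin.cons a z) - m)) ∂(μ 0)
        ≤ Real.exp (c 0 ^ 2 * t ^ 2 / 8) * Real.exp (t * (g₁ z - m)) := by
      intro z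
      have hbb : BddBelow (Set.range fun a => g (Fin.cons a z)) :=
        ⟨-M, by rintro _ ⟨a, rfl⟩; exact (abs_le.1 (hbd _)).1⟩
      have hba : BddAbove (Set.range fun a => g (Fin.cons a z)) :=
        ⟨M, by rintro _ ⟨a, rfl⟩; exact (abs_le.1 (hbd _)).2⟩
      have hosc : |(⨆ a, g (Fin.cons a z)) - ⨅ a, g (Fin.cons a z)| ≤ c 0 := by
        rw [abs_of_nonneg (sub_nonneg.2 (ciInf_le_ciSup hbb hba)), sub_le_iff_le_add]
        refine ciSup_le fun a => ?_
        rw [← sub_le_iff_le_add']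
        refine le_ciInf fun a' => ?_
        have := (abs_le.1 (hg 0 (Fin.cons a z) (Fin.cons a' z) fun j hj => by
          obtain ⟨j, rfl⟩ := Fin.exists_succ_eq.2 hj
          simp)).2
        linarith
      have hH := (hasSubgaussianMGF_of_mem_Icc (μ := μ 0) (X := fun a => g (Fin.cons a z))
        (hsec z).aemeasurable (Filter.Eventually.of_forall fun a =>
          ⟨ciInf_le hbb a, le_ciSup hba a⟩)).mgf_le t
      calc ∫ a, Real.exp (t * (g (Fin.cons a z) - m)) ∂(μ 0)
          = ∫ a, Real.exp (t * (g (Fin.cons a z) - g₁ z)) * Real.exp (t * (g₁ z - m)) ∂(μ 0) := by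
            congr 1; ext a; rw [← Real.exp_add]; ring_nf
        _ = mgf (fun a => g (Fin.cons a z) - g₁ z) (μ 0) t * Real.exp (t * (g₁ z - m)) := by
            rw [integral_mul_const, mgf]
        _ ≤ _ := by
            gcongr
            refine hH.trans (Real.exp_le_exp.2 ?_)
            simp only [NNReal.coe_pow, NNReal.coe_div, coe_nnnorm, Real.norm_eq_abs,
              NNReal.coe_ofNat]
            have := pow_le_pow_left₀ (abs_nonneg _) hosc 2
            nlinarith [sq_nonneg t, mul_le_mul_of_nonneg_right this (sq_nonneg t)]
    have hint₂ : Integrable (fun z => Real.exp (t * (g₁ z - m))) ν :=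
      Integrable.of_bound (by fun_prop) _ (Filter.Eventually.of_forall fun z => hexpb _ (hg₁b z))
    calc _ ≤ ∫ z, Real.exp (c 0 ^ 2 * t ^ 2 / 8) * Real.exp (t * (g₁ z - m)) ∂ν := by
          refine integral_mono_of_nonneg
            (Filter.Eventually.of_forall fun z => integral_nonneg fun a => (Real.exp_pos _).le)
            (hint₂.const_mul _) (Filter.Eventually.of_forall hinner)
      _ ≤ Real.exp (c 0 ^ 2 * t ^ 2 / 8)
            * Real.exp ((∑ i : Fin n, c i.succ ^ 2) * t ^ 2 / 8) := by
          rw [integral_const_mul]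
          gcongr
          exact ih _ hg₁m hg₁d
      _ = _ := by rw [← Real.exp_add, Fin.sum_univ_succ]; ring_nf

/-- **McDiarmid's inequality** in sub-Gaussian form. -/
lemma hasSubgaussianMGF_of_bounded_differences {X : Type*} [MeasurableSpace X] {n : ℕ}
    (μ : Fin n → Measure X) [∀ i, IsProbabilityMeasure (μ i)] {g : (Fin n → X) → ℝ}
    (hgm : Measurable g) {c : Fin n → ℝ}
    (hg : ∀ i x y, (∀ j, j ≠ i → x j = y j) → |g x - g y| ≤ c i) :
    HasSubgaussianMGF (fun x => g x - ∫ y, g y ∂Measure.pi μ)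
      (Real.toNNReal ((∑ i, c i ^ 2) / 4)) (Measure.pi μ) where
  integrable_exp_mul t := by
    obtain ⟨x₀⟩ : Nonempty (Fin n → X) := (Measure.pi μ).nonempty_of_neZero
    set m := ∫ y, g y ∂Measure.pi μ
    refine Integrable.of_bound (by fun_prop)
      (Real.exp (|t| * ((∑ i, c i) + |g x₀ - m|))) (Filter.Eventually.of_forall fun x => ?_)
    rw [Real.norm_eq_abs, abs_of_pos (Real.exp_pos _), Real.exp_le_exp]
    calc t * (g x - m) ≤ |t * (g x - m)| := le_abs_self _
      _ = |t| * |g x - m| := abs_mul _ _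
      _ ≤ _ := by
        gcongr
        exact (abs_sub_le _ (g x₀) _).trans
          (by gcongr; exact abs_sub_le_sum_of_bounded_differences hg x x₀)
  mgf_le t := by
    refine (mgf_le_of_bounded_differences μ hgm hg t).trans (Real.exp_le_exp.2 ?_)
    rw [Real.coe_toNNReal _ (by positivity)]
    exact le_of_eq (by ring)

/-- The square-exponential moment of a centred sub-Gaussian variable: `exp (s X ^ 2)` is the
average of `exp (√(2 s) g X)` over a standard Gaussian `g`, and the two averages commute. -/
lemma lintegral_exp_mul_sq_le_two {Ω : Type*} [MeasurableSpace Ω] {μ : Measure Ω} [SFinite μ]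
    {Y : Ω → ℝ} (hYm : Measurable Y) {c : ℝ≥0} (hY : HasSubgaussianMGF Y c μ) {s : ℝ} (hs : 0 ≤ s)
    (hsc : s * c ≤ 3 / 8) :
    ∫⁻ ω, ENNReal.ofReal (Real.exp (s * Y ω ^ 2)) ∂μ ≤ 2 := by
  have key : ∀ ω, ENNReal.ofReal (Real.exp (s * Y ω ^ 2))
      = ∫⁻ x, ENNReal.ofReal (Real.exp (√(2 * s) * x * Y ω)) ∂(gaussianReal 0 1) := by
    intro ω
    have h1 : ∀ x, √(2 * s) * x * Y ω = (√(2 * s) * Y ω) * x := fun x => by ring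
    simp only [h1]
    rw [← ofReal_integral_eq_lintegral_ofReal (integrable_exp_mul_gaussianReal _)
      (Filter.Eventually.of_forall fun x => (Real.exp_pos _).le)]
    have := congrFun (mgf_id_gaussianReal (μ := 0) (v := 1)) (√(2 * s) * Y ω)
    simp only [mgf, id] at this
    rw [this, mul_pow, Real.sq_sqrt (by positivity)]
    congr 2
    simp only [NNReal.coe_one]
    ring
  have hmeas : Measurable fun p : Ω × ℝ =>
      ENNReal.ofReal (Real.exp (√(2 * s) * p.2 * Y p.1)) := by fun_prop
  have hgauss : Integrable (fun x : ℝ => Real.exp (-(1 / 8) * x ^ 2)) :=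
    integrable_exp_neg_mul_sq (by norm_num)
  calc ∫⁻ ω, ENNReal.ofReal (Real.exp (s * Y ω ^ 2)) ∂μ
      = ∫⁻ x, ∫⁻ ω, ENNReal.ofReal (Real.exp (√(2 * s) * x * Y ω)) ∂μ ∂(gaussianReal 0 1) := by
        simp only [key]
        exact lintegral_lintegral_swap hmeas.aemeasurable
    _ ≤ ∫⁻ x, ENNReal.ofReal (Real.exp (3 / 8 * x ^ 2)) ∂(gaussianReal 0 1) := by
        refine lintegral_mono fun x => ?_
        rw [← ofReal_integral_eq_lintegral_ofReal (hY.integrable_exp_mul _)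
          (Filter.Eventually.of_forall fun x => (Real.exp_pos _).le)]
        refine ENNReal.ofReal_le_ofReal ((hY.mgf_le _).trans (Real.exp_le_exp.2 ?_))
        rw [mul_pow, Real.sq_sqrt (by positivity)]
        nlinarith [mul_le_mul_of_nonneg_right hsc (sq_nonneg x)]
    _ = ∫⁻ x, ENNReal.ofReal ((√(2 * Real.pi))⁻¹ * Real.exp (-(1 / 8) * x ^ 2)) := by
        rw [gaussianReal_of_var_ne_zero 0 one_ne_zero, lintegral_withDensity_eq_lintegral_mul _
          (measurable_gaussianPDF 0 1) (by fun_prop)]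
        refine lintegral_congr fun x => ?_
        rw [Pi.mul_apply, gaussianPDF, ← ENNReal.ofReal_mul (gaussianPDFReal_nonneg _ _ _),
          gaussianPDFReal, mul_assoc, ← Real.exp_add]
        simp only [NNReal.coe_one, mul_one]
        ring_nf
    _ = 2 := by
        rw [← ofReal_integral_eq_lintegral_ofReal (hgauss.const_mul _)
          (Filter.Eventually.of_forall fun x => by positivity), integral_const_mul,
          integral_gaussian, ← Real.sqrt_inv, ← Real.sqrt_mul (by positivity)]
        have : (2 * Real.pi)⁻¹ * (Real.pi / (1 / 8)) = 2 ^ 2 := by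
          field_simp; norm_num
        rw [this, Real.sqrt_sq (by norm_num)]
        simp

/-! ### Rademacher averages -/

/-- The Rademacher sign attached to a Boolean. -/
def sgn (b : Bool) : ℝ := if b then 1 else -1

@[simp] lemma sgn_true : sgn true = 1 := rfl

@[simp] lemma sgn_false : sgn false = -1 := rfl

lemma abs_sgn (b : Bool) : |sgn b| = 1 := by cases b <;> simp

/-- Splitting off the first sign in a sum over all sign patterns. -/
lemma sum_signs_succ {n : ℕ} (F : (Fin (n + 1) → Bool) → ℝ) :
    ∑ σ, F σ = ∑ σ : Fin n → Bool, (F (Fin.cons true σ) + F (Fin.cons false σ)) := by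
  rw [← (Fin.consEquiv fun _ => Bool).sum_comp, Fintype.sum_prod_type, Finset.sum_comm]
  simp [Fin.consEquiv]

/-- One step of the contraction principle: a single sign is averaged, and the `L`-Lipschitz
function attached to it is replaced by multiplication by `L`. -/
lemma ciSup_add_ciSup_le_of_lipschitz {U : Type*} [Nonempty U] {b z : U → ℝ} {ψ : ℝ → ℝ} {L : ℝ}
    (hψ : ∀ s t, |ψ s - ψ t| ≤ L * |s - t|)
    (h1 : BddAbove (Set.range fun u => b u + L * z u))
    (h2 : BddAbove (Set.range fun u => b u - L * z u)) :
    (⨆ u, (b u + ψ (z u))) + ⨆ u, (b u - ψ (z u))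
      ≤ (⨆ u, (b u + L * z u)) + ⨆ u, (b u - L * z u) := by
  -- The order of `z u` and `z v` decides which of `u`, `v` enters the first supremum on the right.
  have key : ∀ u v, b u + ψ (z u) + (b v - ψ (z v))
      ≤ (⨆ u, (b u + L * z u)) + ⨆ u, (b u - L * z u) := by
    intro u v
    have hd := (abs_le.1 (hψ (z u) (z v))).2
    have hu1 := le_ciSup h1 u
    have hu2 := le_ciSup h2 u
    have hv1 := le_ciSup h1 v
    have hv2 := le_ciSup h2 v
    rcases abs_cases (z u - z v) with ⟨h, -⟩ | ⟨h, -⟩ <;> rw [h] at hd <;> linarith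
  rw [← le_sub_iff_add_le]
  refine ciSup_le fun u => ?_
  rw [le_sub_iff_add_le, ← le_sub_iff_add_le']
  exact ciSup_le fun v => by linarith [key u v]

/-- The **contraction principle** for Rademacher averages, with a shift `b` that makes the
induction on the number of signs possible. -/
lemma sum_signs_iSup_le_of_lipschitz {U : Type*} [Nonempty U] {n : ℕ} (b : U → ℝ)
    (z : Fin n → U → ℝ) (ψ : Fin n → ℝ → ℝ) (L : Fin n → ℝ)
    (hψ : ∀ i s t, |ψ i s - ψ i t| ≤ L i * |s - t|)
    (hb : ∃ C, ∀ u, |b u| ≤ C) (hz : ∀ i, ∃ C, ∀ u, |z i u| ≤ C) :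
    ∑ σ : Fin n → Bool, ⨆ u, (b u + ∑ i, sgn (σ i) * ψ i (z i u))
      ≤ ∑ σ : Fin n → Bool, ⨆ u, (b u + ∑ i, sgn (σ i) * (L i * z i u)) := by
  induction n generalizing b with
  | zero => simp
  | succ n ih =>
    obtain ⟨Cb, hCb⟩ := hb
    choose C hC using hz
    have hψb : ∀ i u, |ψ i (z i u)| ≤ |ψ i 0| + |L i| * C i := by
      intro i u
      have h1 := hψ i (z i u) 0
      rw [sub_zero] at h1
      have h2 : L i * |z i u| ≤ |L i| * C i :=
        mul_le_mul (le_abs_self _) (hC i u) (abs_nonneg _) (abs_nonneg _)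
      have h3 := abs_sub_abs_le_abs_sub (ψ i (z i u)) (ψ i 0)
      linarith
    have hLb : ∀ i u, |L i * z i u| ≤ |L i| * C i := fun i u => by
      rw [abs_mul]; exact mul_le_mul_of_nonneg_left (hC i u) (abs_nonneg _)
    rw [sum_signs_succ, sum_signs_succ]
    simp only [Fin.sum_univ_succ, Fin.cons_zero, Fin.cons_succ]
    -- The first sign is contracted with the remaining Lipschitz functions inside the shift.
    have hstep : ∀ σ : Fin n → Bool,
        (⨆ u, (b u + (sgn true * ψ 0 (z 0 u) + ∑ i, sgn (σ i) * ψ i.succ (z i.succ u))))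
          + ⨆ u, (b u + (sgn false * ψ 0 (z 0 u) + ∑ i, sgn (σ i) * ψ i.succ (z i.succ u)))
        ≤ (⨆ u, (b u + L 0 * z 0 u + ∑ i, sgn (σ i) * ψ i.succ (z i.succ u)))
          + ⨆ u, (b u - L 0 * z 0 u + ∑ i, sgn (σ i) * ψ i.succ (z i.succ u)) := by
      intro σ
      have hS : ∀ u, |b u + ∑ i, sgn (σ i) * ψ i.succ (z i.succ u)|
          ≤ Cb + ∑ i : Fin n, (|ψ i.succ 0| + |L i.succ| * C i.succ) := by
        intro u
        refine (abs_add_le _ _).trans (add_le_add (hCb u) ?_)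
        refine (Finset.abs_sum_le_sum_abs _ _).trans (Finset.sum_le_sum fun i _ => ?_)
        rw [abs_mul, abs_sgn, one_mul]
        exact hψb _ _
      have := ciSup_add_ciSup_le_of_lipschitz (U := U)
        (b := fun u => b u + ∑ i, sgn (σ i) * ψ i.succ (z i.succ u)) (z := z 0) (hψ 0)
        ⟨Cb + ∑ i : Fin n, (|ψ i.succ 0| + |L i.succ| * C i.succ) + |L 0| * C 0, by
          rintro _ ⟨u, rfl⟩
          have h1 := (abs_le.1 (hS u)).2
          have h2 := (abs_le.1 (hLb 0 u)).2
          dsimp only; linarith⟩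
        ⟨Cb + ∑ i : Fin n, (|ψ i.succ 0| + |L i.succ| * C i.succ) + |L 0| * C 0, by
          rintro _ ⟨u, rfl⟩
          have h1 := (abs_le.1 (hS u)).2
          have h2 := (abs_le.1 (hLb 0 u)).1
          dsimp only; linarith⟩
      simp only [sgn_true, sgn_false]
      convert this using 3 <;> (funext u; ring)
    refine (Finset.sum_le_sum fun σ _ => hstep σ).trans ?_
    rw [Finset.sum_add_distrib]
    have hih := fun b hb => ih b (fun i => z i.succ) (fun i => ψ i.succ) (fun i => L i.succ)
      (fun i => hψ i.succ) hb (fun i => ⟨C i.succ, hC i.succ⟩)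
    have ht := hih (fun u => b u + L 0 * z 0 u) ⟨Cb + |L 0| * C 0, fun u =>
      (abs_add_le _ _).trans (add_le_add (hCb u) (hLb 0 u))⟩
    have hf := hih (fun u => b u - L 0 * z 0 u) ⟨Cb + |L 0| * C 0, fun u =>
      (abs_sub _ _).trans (add_le_add (hCb u) (hLb 0 u))⟩
    refine (add_le_add ht hf).trans (le_of_eq ?_)
    rw [← Finset.sum_add_distrib]
    refine Finset.sum_congr rfl fun σ _ => ?_
    congr 2 <;> (funext u; simp only [sgn_true, sgn_false]; ring)

/-- Random signs are orthogonal: the second moment of a signed sum of vectors. -/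
lemma sum_signs_norm_sq {H : Type*} [NormedAddCommGroup H] [InnerProductSpace ℝ H] {n : ℕ} (y : H)
    (v : Fin n → H) :
    ∑ σ : Fin n → Bool, ‖y + ∑ i, sgn (σ i) • v i‖ ^ 2 = 2 ^ n * (‖y‖ ^ 2 + ∑ i, ‖v i‖ ^ 2) := by
  induction n generalizing y with
  | zero => simp
  | succ n ih =>
    rw [sum_signs_succ]
    simp only [Fin.sum_univ_succ, Fin.cons_zero, Fin.cons_succ, ← add_assoc]
    rw [Finset.sum_add_distrib, ih, ih]
    have := parallelogram_law_with_norm ℝ y (v 0)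
    simp only [sgn_true, sgn_false, one_smul, neg_smul, ← sub_eq_add_neg]
    rw [pow_succ]
    linear_combination (2 : ℝ) ^ n * this

/-- The average norm of a randomly signed sum, bounded through its second moment. -/
lemma sum_signs_norm_le {H : Type*} [NormedAddCommGroup H] [InnerProductSpace ℝ H] {n : ℕ}
    (v : Fin n → H) :
    ∑ σ : Fin n → Bool, ‖∑ i, sgn (σ i) • v i‖ ≤ 2 ^ n * √(∑ i, ‖v i‖ ^ 2) := by
  have h1 := sq_sum_le_card_mul_sum_sq (s := (Finset.univ : Finset (Fin n → Bool)))
    (f := fun σ => ‖∑ i, sgn (σ i) • v i‖)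
  have h2 := sum_signs_norm_sq (0 : H) v
  simp only [zero_add, norm_zero, ne_eq, OfNat.ofNat_ne_zero, not_false_eq_true, zero_pow] at h2
  rw [h2] at h1
  refine (Real.le_sqrt_of_sq_le h1).trans (le_of_eq ?_)
  have hc : (((Finset.univ : Finset (Fin n → Bool)).card : ℕ) : ℝ) = 2 ^ n := by simp
  rw [hc, ← mul_assoc, Real.sqrt_mul (by positivity), Real.sqrt_mul_self (by positivity)]

/-! ### Suprema over the unit ball -/

section BallSup

variable {X H ι : Type*} [NormedAddCommGroup H] [InnerProductSpace ℝ H]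

/-- The supremum, over the unit ball of a Hilbert space, of a function `F` of the values
`⟪u, v i⟫` of the linear functional `u` at finitely many vectors. -/
noncomputable def ballSup (v : ι → H) (F : (ι → ℝ) → ℝ) : ℝ :=
  ⨆ u : Metric.closedBall (0 : H) 1, F fun i => inner ℝ (u : H) (v i)

instance : Nonempty (Metric.closedBall (0 : H) 1) := ⟨⟨0, by simp⟩⟩

lemma abs_inner_le_of_mem_ball (u : Metric.closedBall (0 : H) 1) (v : H) :
    |inner ℝ (u : H) v| ≤ ‖v‖ := by
  have := abs_real_inner_le_norm (u : H) v
  have hu : ‖(u : H)‖ ≤ 1 := mem_closedBall_zero_iff.1 u.2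
  nlinarith [norm_nonneg v]

lemma bddAbove_ballSup (v : ι → H) {F : (ι → ℝ) → ℝ} (hF : Continuous F) :
    BddAbove (Set.range fun u : Metric.closedBall (0 : H) 1 =>
      F fun i => inner ℝ (u : H) (v i)) := by
  have hK : IsCompact (Set.univ.pi fun i => Set.Icc (-‖v i‖) ‖v i‖) :=
    isCompact_univ_pi fun i => isCompact_Icc
  refine (hK.bddAbove_image hF.continuousOn).mono ?_
  rintro _ ⟨u, rfl⟩
  exact ⟨_, fun i _ => abs_le.1 (abs_inner_le_of_mem_ball u (v i)), rfl⟩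

lemma le_ballSup (v : ι → H) {F : (ι → ℝ) → ℝ} (hF : Continuous F)
    (u : Metric.closedBall (0 : H) 1) : F (fun i => inner ℝ (u : H) (v i)) ≤ ballSup v F :=
  le_ciSup (bddAbove_ballSup v hF) u

/-- The supremum over the unit ball is a supremum over a countable set: `u` may be projected to
the span of the vectors, where the coefficients may be taken in a countable dense set. Vectors
outside the unit ball are radially retracted to it. -/
lemma ballSup_eq_iSup_denseSeq [Fintype ι] (v : ι → H) {F : (ι → ℝ) → ℝ} (hF : Continuous F) :
    ballSup v F = ⨆ m : ℕ, F fun i =>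
      (max 1 ‖∑ j, TopologicalSpace.denseSeq (ι → ℝ) m j • v j‖)⁻¹
        * ∑ j, TopologicalSpace.denseSeq (ι → ℝ) m j * inner ℝ (v j) (v i) := by
  set h : (ι → ℝ) → ℝ := fun c => F fun i =>
    (max 1 ‖∑ j, c j • v j‖)⁻¹ * ∑ j, c j * inner ℝ (v j) (v i) with hh
  have hcont : Continuous h := by
    refine hF.comp (continuous_pi fun i => Continuous.mul (Continuous.inv₀ (by fun_prop) ?_)
      (by fun_prop))
    intro c
    exact (lt_of_lt_of_le one_pos (le_max_left _ _)).ne'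
  have hle : ∀ c, h c ≤ ballSup v F := by
    intro c
    have hpos : 0 < max 1 ‖∑ j, c j • v j‖ := lt_of_lt_of_le one_pos (le_max_left _ _)
    have hmem : (max 1 ‖∑ j, c j • v j‖)⁻¹ • ∑ j, c j • v j ∈ Metric.closedBall (0 : H) 1 := by
      rw [mem_closedBall_zero_iff, norm_smul, norm_inv, Real.norm_of_nonneg hpos.le,
        inv_mul_le_one₀ hpos]
      exact le_max_right _ _
    refine le_of_eq_of_le ?_ (le_ballSup v hF ⟨_, hmem⟩)
    simp [hh, inner_smul_left, sum_inner]
  have hbdd : BddAbove (Set.range fun m => h (TopologicalSpace.denseSeq (ι → ℝ) m)) :=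
    ⟨ballSup v F, by rintro _ ⟨m, rfl⟩; exact hle _⟩
  have hall : ∀ c, h c ≤ ⨆ m, h (TopologicalSpace.denseSeq (ι → ℝ) m) := by
    intro c
    have hcl : IsClosed {c | h c ≤ ⨆ m, h (TopologicalSpace.denseSeq (ι → ℝ) m)} :=
      isClosed_le hcont continuous_const
    exact (TopologicalSpace.denseRange_denseSeq (ι → ℝ)).induction_on c hcl fun m =>
      le_ciSup hbdd m
  refine le_antisymm (ciSup_le fun u => ?_) (ciSup_le fun m => hle _)
  -- `u` is replaced by its orthogonal projection to the span of the vectors.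
  set V : Submodule ℝ H := Submodule.span ℝ (Set.range v)
  have : FiniteDimensional ℝ V := FiniteDimensional.span_of_finite ℝ (Set.finite_range v)
  obtain ⟨c, hc⟩ := (Submodule.mem_span_range_iff_exists_fun ℝ).1
    (V.starProjection_apply_mem (u : H))
  have hinner : ∀ i, inner ℝ (u : H) (v i) = ∑ j, c j * inner ℝ (v j) (v i) := by
    intro i
    have hvi : v i ∈ V := Submodule.subset_span ⟨i, rfl⟩
    have h0 : inner ℝ ((u : H) - V.starProjection u) (v i) = 0 :=
      V.starProjection_inner_eq_zero _ _ hvi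
    rw [inner_sub_left, sub_eq_zero] at h0
    rw [h0, ← hc, sum_inner]
    simp [inner_smul_left]
  have hnorm : ‖∑ j, c j • v j‖ ≤ 1 := by
    rw [hc]
    exact (V.norm_starProjection_apply_le _).trans (mem_closedBall_zero_iff.1 u.2)
  refine le_of_eq_of_le ?_ (hall c)
  simp only [hh, hinner, max_eq_left hnorm, inv_one, one_mul]

lemma measurable_ballSup [MeasurableSpace X] [Fintype ι] {Φ : X → H}
    (hΦ : Measurable fun p : X × X => (inner ℝ (Φ p.1) (Φ p.2) : ℝ))
    {F : (ι → ℝ) → ℝ} (hF : Continuous F) :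
    Measurable fun x : ι → X => ballSup (fun i => Φ (x i)) F := by
  have hpair : ∀ i j : ι, Measurable fun x : ι → X => (inner ℝ (Φ (x i)) (Φ (x j)) : ℝ) :=
    fun i j => by
      have h : Measurable fun x : ι → X => (x i, x j) := by fun_prop
      exact hΦ.comp h
  have hnorm : ∀ (c : ι → ℝ) (x : ι → X), ‖∑ j, c j • Φ (x j)‖
      = √(∑ j, ∑ l, c j * (c l * inner ℝ (Φ (x j)) (Φ (x l)))) := by
    intro c x
    rw [norm_eq_sqrt_real_inner, sum_inner]
    simp only [inner_sum, inner_smul_left, inner_smul_right]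
    refine congrArg _ (Finset.sum_congr rfl fun j _ => Finset.sum_congr rfl fun l _ => ?_)
    simp only [conj_trivial]
    ring
  simp only [ballSup_eq_iSup_denseSeq _ hF, hnorm]
  refine Measurable.iSup fun m => hF.measurable.comp (measurable_pi_lambda _ fun i => ?_)
  fun_prop

/-- A linear functional is measurable along the feature map: the vectors `w` for which this holds
form a closed subspace that contains all features and everything orthogonal to them. -/
lemma measurable_inner_feature [MeasurableSpace X] [CompleteSpace H] {Φ : X → H}
    (hΦ : Measurable fun p : X × X => (inner ℝ (Φ p.1) (Φ p.2) : ℝ)) (w : H) :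
    Measurable fun x => (inner ℝ w (Φ x) : ℝ) := by
  let M : Submodule ℝ H :=
    { carrier := {w | Measurable fun x => (inner ℝ w (Φ x) : ℝ)}
      add_mem' := fun {a b} ha hb => by
        simp only [Set.mem_ofPred_eq, inner_add_left] at *
        exact ha.add hb
      zero_mem' := by simp
      smul_mem' := fun c a ha => by
        simp only [Set.mem_ofPred_eq, inner_smul_left] at *
        exact ha.const_mul _ }
  have hMc : IsClosed (M : Set H) := by
    refine IsSeqClosed.isClosed fun a w ha haw => ?_
    exact measurable_of_tendsto_metrizable ha
      (tendsto_pi_nhds.2 fun x => haw.inner tendsto_const_nhds)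
  set V : Submodule ℝ H := (Submodule.span ℝ (Set.range Φ)).topologicalClosure
  have hVM : V ≤ M := by
    refine Submodule.topologicalClosure_minimal _ (Submodule.span_le.2 ?_) hMc
    rintro _ ⟨x, rfl⟩
    exact hΦ.comp (measurable_const.prodMk measurable_id)
  have : CompleteSpace V :=
    (Submodule.isClosed_topologicalClosure _).completeSpace_coe
  have hVo : Vᗮ ≤ M := by
    intro y hy
    have : ∀ x, inner ℝ y (Φ x) = 0 := fun x =>
      (Submodule.mem_orthogonal' V y).1 hy _
        (Submodule.le_topologicalClosure _ (Submodule.subset_span ⟨x, rfl⟩))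
    change Measurable fun x => (inner ℝ y (Φ x) : ℝ)
    simp [this]
  have htop : (⊤ : Submodule ℝ H) ≤ M := by
    rw [← Submodule.sup_orthogonal_of_hasOrthogonalProjection (K := V)]
    exact sup_le hVM hVo
  exact htop (Submodule.mem_top (x := w))

/-- The Rademacher complexity of the unit ball after composition with Lipschitz functions. -/
lemma sum_signs_ballSup_le {n : ℕ} (v : Fin n → H) (ψ : Fin n → ℝ → ℝ) {L : Fin n → ℝ≥0}
    (hψ : ∀ i, LipschitzWith (L i) (ψ i)) :
    ∑ σ : Fin n → Bool, ballSup v (fun z => ∑ i, sgn (σ i) * ψ i (z i))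
      ≤ 2 ^ n * √(∑ i, (L i * ‖v i‖) ^ 2) := by
  have h1 := sum_signs_iSup_le_of_lipschitz (U := Metric.closedBall (0 : H) 1) (fun _ => 0)
    (fun i u => inner ℝ (u : H) (v i)) ψ (fun i => L i)
    (fun i s t => by simpa [Real.dist_eq] using (hψ i).dist_le_mul s t)
    ⟨0, by simp⟩ (fun i => ⟨_, fun u => abs_inner_le_of_mem_ball u (v i)⟩)
  simp only [zero_add] at h1
  refine h1.trans ?_
  have h2 : ∀ σ : Fin n → Bool,
      (⨆ u : Metric.closedBall (0 : H) 1, ∑ i, sgn (σ i) * ((L i : ℝ) * inner ℝ (u : H) (v i)))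
        ≤ ‖∑ i, sgn (σ i) • ((L i : ℝ) • v i)‖ := by
    intro σ
    refine ciSup_le fun u => ?_
    refine le_of_eq_of_le ?_ ((le_abs_self _).trans (abs_inner_le_of_mem_ball u _))
    simp [inner_sum, inner_smul_right]
  refine (Finset.sum_le_sum fun σ _ => h2 σ).trans ((sum_signs_norm_le _).trans (le_of_eq ?_))
  simp [norm_smul]

end BallSup

/-! ### Uniform deviations over the unit ball -/

section UniformDeviation

variable {X H : Type*} [NormedAddCommGroup H] [InnerProductSpace ℝ H] {n : ℕ}

/-- The supremum over the unit ball of the difference between the sums of the losses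
`ψ i ⟪u, Φ ·⟫` over a ghost sample `x'` and over the sample `x`. -/
noncomputable def ghostSup (Φ : X → H) (ψ : Fin n → ℝ → ℝ) (x x' : Fin n → X) : ℝ :=
  ballSup (fun j : Fin n ⊕ Fin n => Φ (Sum.elim x x' j))
    fun z => ∑ i, (ψ i (z (Sum.inr i)) - ψ i (z (Sum.inl i)))

variable {Φ : X → H} {ψ : Fin n → ℝ → ℝ}

lemma continuous_sum_sub (hψ : ∀ i, Continuous (ψ i)) :
    Continuous fun z : Fin n ⊕ Fin n → ℝ => ∑ i, (ψ i (z (Sum.inr i)) - ψ i (z (Sum.inl i))) :=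
  continuous_finsetSum _ fun i _ =>
    ((hψ i).comp (continuous_apply _)).sub ((hψ i).comp (continuous_apply _))

lemma le_ghostSup (hψ : ∀ i, Continuous (ψ i)) (x x' : Fin n → X)
    (u : Metric.closedBall (0 : H) 1) :
    ∑ i, (ψ i (inner ℝ (u : H) (Φ (x' i))) - ψ i (inner ℝ (u : H) (Φ (x i))))
      ≤ ghostSup Φ ψ x x' :=
  le_ballSup (fun j : Fin n ⊕ Fin n => Φ (Sum.elim x x' j)) (continuous_sum_sub hψ) u

lemma ghostSup_le {x x' : Fin n → X} {C : ℝ}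
    (h : ∀ u : Metric.closedBall (0 : H) 1,
      ∑ i, (ψ i (inner ℝ (u : H) (Φ (x' i))) - ψ i (inner ℝ (u : H) (Φ (x i)))) ≤ C) :
    ghostSup Φ ψ x x' ≤ C :=
  ciSup_le h

lemma measurable_ghostSup [MeasurableSpace X]
    (hΦ : Measurable fun p : X × X => (inner ℝ (Φ p.1) (Φ p.2) : ℝ)) (hψ : ∀ i, Continuous (ψ i)) :
    Measurable fun p : (Fin n → X) × (Fin n → X) => ghostSup Φ ψ p.1 p.2 := by
  have h : Measurable fun p : (Fin n → X) × (Fin n → X) =>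
      (Sum.elim p.1 p.2 : Fin n ⊕ Fin n → X) := by
    refine measurable_pi_lambda _ ?_
    rintro (i | i)
    · exact (measurable_pi_apply i).comp measurable_fst
    · exact (measurable_pi_apply i).comp measurable_snd
  exact (measurable_ballSup hΦ (continuous_sum_sub hψ)).comp h

section Bounded

variable {c : Fin n → ℝ}

lemma abs_ghostSup_le (hψ : ∀ i, Continuous (ψ i))
    (hc : ∀ i (u : Metric.closedBall (0 : H) 1) x, ψ i (inner ℝ (u : H) (Φ x)) ∈ Set.Icc 0 (c i))
    (x x' : Fin n → X) : |ghostSup Φ ψ x x'| ≤ ∑ i, c i := by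
  have key : ∀ u : Metric.closedBall (0 : H) 1,
      |∑ i, (ψ i (inner ℝ (u : H) (Φ (x' i))) - ψ i (inner ℝ (u : H) (Φ (x i))))| ≤ ∑ i, c i := by
    intro u
    refine (Finset.abs_sum_le_sum_abs _ _).trans (Finset.sum_le_sum fun i _ => ?_)
    have h1 := hc i u (x' i)
    have h2 := hc i u (x i)
    exact abs_le.2 ⟨by linarith [h1.1, h2.2], by linarith [h1.2, h2.1]⟩
  refine abs_le.2 ⟨?_, ghostSup_le fun u => (abs_le.1 (key u)).2⟩
  exact (abs_le.1 (key ⟨0, by simp⟩)).1.trans (le_ghostSup hψ x x' _)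

lemma ghostSup_le_add_of_eq_off (hψ : ∀ i, Continuous (ψ i))
    (hc : ∀ i (u : Metric.closedBall (0 : H) 1) x, ψ i (inner ℝ (u : H) (Φ x)) ∈ Set.Icc 0 (c i))
    (i : Fin n) {x y : Fin n → X} (hxy : ∀ j, j ≠ i → x j = y j) (x' : Fin n → X) :
    ghostSup Φ ψ x x' ≤ ghostSup Φ ψ y x' + c i := by
  refine ghostSup_le fun u => ?_
  have h := le_ghostSup (Φ := Φ) hψ y x' u
  have hdiff : ∑ j, (ψ j (inner ℝ (u : H) (Φ (x' j))) - ψ j (inner ℝ (u : H) (Φ (x j))))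
      - ∑ j, (ψ j (inner ℝ (u : H) (Φ (x' j))) - ψ j (inner ℝ (u : H) (Φ (y j))))
      = ψ i (inner ℝ (u : H) (Φ (y i))) - ψ i (inner ℝ (u : H) (Φ (x i))) := by
    rw [← Finset.sum_sub_distrib, Finset.sum_eq_single i]
    · ring
    · intro j _ hj
      rw [hxy j hj, sub_self]
    · simp
  have h1 := hc i u (y i)
  have h2 := hc i u (x i)
  linarith [h1.2, h2.1]

variable [MeasurableSpace X] (μ : Fin n → Measure X) [∀ i, IsProbabilityMeasure (μ i)]

/-- **Symmetrization**: exchanging the sample and the ghost sample at any set of indices preserves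
their joint law, so the mean of `ghostSup` is at most twice a Rademacher average. -/
lemma integral_ghostSup_le {r : ℝ} (hr : ∀ x, ‖Φ x‖ ≤ r)
    (hΦ : Measurable fun p : X × X => (inner ℝ (Φ p.1) (Φ p.2) : ℝ))
    {L : Fin n → ℝ≥0} (hψ : ∀ i, LipschitzWith (L i) (ψ i))
    (hc : ∀ i (u : Metric.closedBall (0 : H) 1) x, ψ i (inner ℝ (u : H) (Φ x)) ∈ Set.Icc 0 (c i)) :
    ∫ x, ∫ x', ghostSup Φ ψ x x' ∂Measure.pi μ ∂Measure.pi μ ≤ 2 * √(∑ i, (L i * r) ^ 2) := by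
  have hψc : ∀ i, Continuous (ψ i) := fun i => (hψ i).continuous
  have hm := measurable_ghostSup hΦ hψc
  have hQm : Measurable fun z : Fin n → X × X =>
      ghostSup Φ ψ (fun i => (z i).1) fun i => (z i).2 := by
    have h : Measurable fun z : Fin n → X × X => ((fun i => (z i).1, fun i => (z i).2) :
        (Fin n → X) × (Fin n → X)) := by fun_prop
    have := hm.comp h
    simpa only [Function.comp_def] using this
  set Q : (Fin n → X × X) → ℝ := fun z => ghostSup Φ ψ (fun i => (z i).1) fun i => (z i).2
  have hQi : ∀ T : (Fin n → X × X) → (Fin n → X × X), Measurable T →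
      Integrable (fun z => Q (T z)) (Measure.pi fun i => (μ i).prod (μ i)) := fun T hT =>
    Integrable.of_bound (hQm.comp hT).aestronglyMeasurable (∑ i, c i)
      (Filter.Eventually.of_forall fun z => abs_ghostSup_le hψc hc _ _)
  have hpair : ∫ x, ∫ x', ghostSup Φ ψ x x' ∂Measure.pi μ ∂Measure.pi μ
      = ∫ z, Q z ∂(Measure.pi fun i => (μ i).prod (μ i)) := by
    have hmp := measurePreserving_arrowProdEquivProdArrow X X (Fin n) μ μ
    rw [← integral_prod (fun p : (Fin n → X) × (Fin n → X) => ghostSup Φ ψ p.1 p.2)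
      (Integrable.of_bound hm.aestronglyMeasurable (∑ i, c i)
        (Filter.Eventually.of_forall fun p => abs_ghostSup_le hψc hc _ _)),
      ← hmp.map_eq, integral_map hmp.measurable.aemeasurable hm.aestronglyMeasurable]
    rfl
  let sw : (Fin n → Bool) → (Fin n → X × X) → (Fin n → X × X) :=
    fun σ z i => if σ i then z i else (z i).swap
  have hsw : ∀ σ, MeasurePreserving (sw σ) (Measure.pi fun i => (μ i).prod (μ i))
      (Measure.pi fun i => (μ i).prod (μ i)) := by
    intro σ
    refine measurePreserving_pi _ _
      (f := fun i (p : X × X) => if σ i then p else p.swap) fun i => ?_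
    cases σ i
    · simpa using Measure.measurePreserving_swap
    · exact MeasurePreserving.id _
  have hinv : ∀ σ, ∫ z, Q (sw σ z) ∂(Measure.pi fun i => (μ i).prod (μ i))
      = ∫ z, Q z ∂(Measure.pi fun i => (μ i).prod (μ i)) := by
    intro σ
    conv_rhs => rw [← (hsw σ).map_eq]
    rw [integral_map (hsw σ).measurable.aemeasurable hQm.aestronglyMeasurable]
  have hcs : ∀ σ : Fin n → Bool,
      Continuous fun z : Fin n → ℝ => ∑ i, sgn (σ i) * ψ i (z i) := fun σ =>
    continuous_finsetSum _ fun i _ => continuous_const.mul ((hψc i).comp (continuous_apply i))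
  have hpt : ∀ σ z, Q (sw σ z)
      ≤ ballSup (fun i => Φ (z i).2) (fun y => ∑ i, sgn (σ i) * ψ i (y i))
        + ballSup (fun i => Φ (z i).1) (fun y => ∑ i, sgn (!σ i) * ψ i (y i)) := by
    intro σ z
    refine ghostSup_le fun u => ?_
    refine le_of_eq_of_le ?_ (add_le_add (le_ballSup (fun i => Φ (z i).2) (hcs σ) u)
      (le_ballSup (fun i => Φ (z i).1) (hcs fun i => !σ i) u))
    rw [← Finset.sum_add_distrib]
    refine Finset.sum_congr rfl fun i _ => ?_
    simp only [sw]
    cases σ i <;> simp <;> ring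
  have hrad : ∀ v : Fin n → X, ∑ σ : Fin n → Bool,
      ballSup (fun i => Φ (v i)) (fun y => ∑ i, sgn (σ i) * ψ i (y i))
        ≤ 2 ^ n * √(∑ i, (L i * r) ^ 2) := by
    intro v
    refine (sum_signs_ballSup_le _ ψ hψ).trans ?_
    gcongr
    exact hr _
  have hsum : ∀ z, ∑ σ, Q (sw σ z) ≤ 2 ^ n * (2 * √(∑ i, (L i * r) ^ 2)) := by
    intro z
    refine (Finset.sum_le_sum fun σ _ => hpt σ z).trans ?_
    rw [Finset.sum_add_distrib]
    have h1 := hrad fun i => (z i).2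
    have h2 := hrad fun i => (z i).1
    rw [← (Equiv.piCongrRight fun _ : Fin n => Equiv.boolNot).sum_comp] at h2
    simp only [Equiv.piCongrRight_apply, Pi.map_apply, Equiv.boolNot_apply] at h2
    linarith
  rw [hpair]
  have h2n : (0 : ℝ) < 2 ^ n := by positivity
  refine le_of_mul_le_mul_left ?_ h2n
  calc 2 ^ n * ∫ z, Q z ∂(Measure.pi fun i => (μ i).prod (μ i))
      = ∫ z, ∑ σ, Q (sw σ z) ∂(Measure.pi fun i => (μ i).prod (μ i)) := by
        rw [integral_finsetSum _ fun σ _ => hQi _ (hsw σ).measurable]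
        simp [hinv]
    _ ≤ ∫ z, 2 ^ n * (2 * √(∑ i, (L i * r) ^ 2)) ∂(Measure.pi fun i => (μ i).prod (μ i)) :=
        integral_mono (integrable_finsetSum _ fun σ _ => hQi _ (hsw σ).measurable)
          (integrable_const _) hsum
    _ = _ := by simp

/-- The uniform deviation between the expected and the empirical sum of losses over the unit ball
is at most a complexity term plus a sub-Gaussian variable. The supremum over the ball is not
known to be measurable because the expected losses enter it; its conditional mean over a ghost
sample dominates it and is measurable. -/
theorem exists_hasSubgaussianMGF_uniform_deviation [CompleteSpace H] {r : ℝ} (hr : ∀ x, ‖Φ x‖ ≤ r)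
    (hΦ : Measurable fun p : X × X => (inner ℝ (Φ p.1) (Φ p.2) : ℝ))
    {L : Fin n → ℝ≥0} (hψ : ∀ i, LipschitzWith (L i) (ψ i))
    (hc : ∀ i (u : Metric.closedBall (0 : H) 1) x, ψ i (inner ℝ (u : H) (Φ x)) ∈ Set.Icc 0 (c i)) :
    ∃ G : (Fin n → X) → ℝ, Measurable G ∧
      HasSubgaussianMGF G (Real.toNNReal ((∑ i, c i ^ 2) / 4)) (Measure.pi μ) ∧
      ∀ x, ∀ u : Metric.closedBall (0 : H) 1,
        ∑ i, ∫ y, ψ i (inner ℝ (u : H) (Φ y)) ∂(μ i)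
          ≤ ∑ i, ψ i (inner ℝ (u : H) (Φ (x i))) + 2 * √(∑ i, (L i * r) ^ 2) + G x := by
  have hψc : ∀ i, Continuous (ψ i) := fun i => (hψ i).continuous
  have hm := measurable_ghostSup hΦ hψc
  set g : (Fin n → X) → ℝ := fun x => ∫ x', ghostSup Φ ψ x x' ∂Measure.pi μ with hg
  have hgm : Measurable g := hm.stronglyMeasurable.integral_prod_right.measurable
  have hint : ∀ x, Integrable (ghostSup Φ ψ x) (Measure.pi μ) := fun x =>
    Integrable.of_bound (hm.comp measurable_prodMk_left).aestronglyMeasurable (∑ i, c i)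
      (Filter.Eventually.of_forall fun p => abs_ghostSup_le hψc hc _ _)
  have hd1 : ∀ i x y, (∀ j, j ≠ i → x j = y j) → g x ≤ g y + c i := by
    intro i x y hxy
    calc g x ≤ ∫ x', (ghostSup Φ ψ y x' + c i) ∂Measure.pi μ :=
          integral_mono (hint x) ((hint y).add (integrable_const _)) fun x' =>
            ghostSup_le_add_of_eq_off hψc hc i hxy x'
      _ = _ := by rw [integral_add (hint y) (integrable_const _)]; simp [hg]
  have hd : ∀ i x y, (∀ j, j ≠ i → x j = y j) → |g x - g y| ≤ c i := fun i x y hxy =>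
    abs_le.2 ⟨by linarith [hd1 i y x fun j hj => (hxy j hj).symm], by linarith [hd1 i x y hxy]⟩
  refine ⟨fun x => g x - ∫ y, g y ∂Measure.pi μ, hgm.sub_const _,
    hasSubgaussianMGF_of_bounded_differences μ hgm hd, fun x u => ?_⟩
  have hmean : ∫ y, g y ∂Measure.pi μ ≤ 2 * √(∑ i, (L i * r) ^ 2) :=
    integral_ghostSup_le μ hr hΦ hψ hc
  have hum : ∀ i, Measurable fun y => ψ i (inner ℝ (u : H) (Φ y)) := fun i =>
    (hψc i).measurable.comp (measurable_inner_feature hΦ u)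
  have hui : ∀ i, Integrable (fun x' : Fin n → X => ψ i (inner ℝ (u : H) (Φ (x' i))))
      (Measure.pi μ) := fun i =>
    Integrable.of_bound ((hum i).comp (measurable_pi_apply i)).aestronglyMeasurable (c i)
      (Filter.Eventually.of_forall fun x' => by
        have := hc i u (x' i)
        rw [Real.norm_of_nonneg this.1]; exact this.2)
  have hghost : ∑ i, ∫ y, ψ i (inner ℝ (u : H) (Φ y)) ∂(μ i)
      - ∑ i, ψ i (inner ℝ (u : H) (Φ (x i))) ≤ g x := by
    have hsub : ∀ i, Integrable (fun x' : Fin n → X =>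
        ψ i (inner ℝ (u : H) (Φ (x' i))) - ψ i (inner ℝ (u : H) (Φ (x i)))) (Measure.pi μ) :=
      fun i => (hui i).sub (integrable_const _)
    calc _ = ∫ x', ∑ i, (ψ i (inner ℝ (u : H) (Φ (x' i))) - ψ i (inner ℝ (u : H) (Φ (x i))))
            ∂Measure.pi μ := by
          rw [integral_finsetSum _ fun i _ => hsub i,
            ← Finset.sum_sub_distrib]
          refine Finset.sum_congr rfl fun i _ => ?_
          rw [integral_sub (hui i) (integrable_const _),
            ← (measurePreserving_eval μ i).map_eq, integral_map
              (measurable_pi_apply i).aemeasurable (hum i).aestronglyMeasurable]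
          simp
      _ ≤ g x := integral_mono
          (integrable_finsetSum _ fun i _ => hsub i) (hint x)
          fun x' => le_ghostSup hψc x x' u
  linarith

end Bounded

end UniformDeviation

/-! ### Conditioning on the values of one label -/

/-- A product of conditional laws is the product law conditioned on a box. -/
lemma pi_cond_eq_cond_pi {Ω : Type*} [MeasurableSpace Ω] {n : ℕ} (P : Measure Ω)
    [IsProbabilityMeasure P] {A : Fin n → Set Ω} (hA : ∀ i, MeasurableSet (A i)) :
    Measure.pi (fun i => P[|A i]) = (Measure.pi fun _ : Fin n => P)[|Set.univ.pi A] := by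
  refine Measure.pi_eq fun s hs => ?_
  rw [cond_apply (MeasurableSet.univ_pi hA), ← Set.pi_inter_distrib, Measure.pi_pi, Measure.pi_pi,
    ENNReal.prod_inv_distrib fun i _ j _ _ => Or.inr (measure_ne_top _ _),
    ← Finset.prod_mul_distrib]
  exact Finset.prod_congr rfl fun i _ => (cond_apply (hA i) P (s i)).symm

section Label

variable {X : Type*} [MeasurableSpace X] {K n : ℕ}

/-- The law of `x` conditionally on the value `b` of the label `k`. -/
noncomputable def classLaw (P : Measure (Example X K)) (k : Fin K) (b : Bool) : Measure X :=
  (P[|{z | z.2 k = b}]).map Prod.fst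

/-- The indices at which the label `k` has the value `b`. -/
def classIdx (D : Dataset X K n) (k : Fin K) (b : Bool) : Finset (Fin n) :=
  Finset.univ.filter fun i => (D i).2 k = b

/-- The values of the label `k` in a data set. -/
def labels (k : Fin K) (D : Dataset X K n) : Fin n → Bool := fun i => (D i).2 k

lemma measurable_label (k : Fin K) : Measurable fun z : Example X K => z.2 k :=
  (measurable_pi_apply k).comp measurable_snd

lemma measurableSet_label (k : Fin K) (b : Bool) :
    MeasurableSet {z : Example X K | z.2 k = b} :=
  measurable_label k (measurableSet_singleton b)

lemma measurable_labels (k : Fin K) : Measurable (labels (X := X) (n := n) k) :=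
  measurable_pi_lambda _ fun i => (measurable_label k).comp (measurable_pi_apply i)

lemma isProbabilityMeasure_classLaw (P : Measure (Example X K)) [IsFiniteMeasure P] {k : Fin K}
    {b : Bool} (h : P {z | z.2 k = b} ≠ 0) : IsProbabilityMeasure (classLaw P k b) :=
  have := cond_isProbabilityMeasure h
  Measure.isProbabilityMeasure_map measurable_fst.aemeasurable

/-- Conditionally on the values of the label `k`, the instances are independent with the laws
`classLaw`. -/
lemma measurePreserving_instances (P : Measure (Example X K)) [IsProbabilityMeasure P] {k : Fin K}
    (hP : ∀ b, P {z | z.2 k = b} ≠ 0) (β : Fin n → Bool) :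
    MeasurePreserving (fun (D : Dataset X K n) i => (D i).1)
      ((Measure.pi fun _ : Fin n => P)[|labels k ← β])
      (Measure.pi fun i => classLaw P k (β i)) := by
  have hβ : labels (X := X) k ⁻¹' {β} = Set.univ.pi fun i => {z | z.2 k = β i} := by
    ext D
    simp [labels, funext_iff]
  have := fun b => isProbabilityMeasure_classLaw P (hP b)
  rw [hβ, ← pi_cond_eq_cond_pi P fun i => measurableSet_label k (β i)]
  exact measurePreserving_pi _ _ fun i => ⟨measurable_fst, rfl⟩

/-- Averaging over the conditional laws given the values of a label. -/
lemma lintegral_labels_le (P : Measure (Example X K)) [IsProbabilityMeasure P] (k : Fin K)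
    {F : (Fin n → Bool) → Dataset X K n → ℝ≥0∞} {C : ℝ≥0∞}
    (hC : ∀ β, ∫⁻ D, F β D ∂((Measure.pi fun _ : Fin n => P)[|labels k ← β]) ≤ C) :
    ∫⁻ D, F (labels k D) D ∂(Measure.pi fun _ : Fin n => P) ≤ C := by
  have hm := measurable_labels (X := X) (n := n) k
  conv_lhs => rw [← sum_meas_smul_cond_fiber hm (Measure.pi fun _ : Fin n => P)]
  rw [lintegral_finsetSum_measure]
  simp only [lintegral_smul_measure, smul_eq_mul]
  calc _ ≤ ∑ β, (Measure.pi fun _ : Fin n => P) (labels k ⁻¹' {β}) * C := by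
        refine Finset.sum_le_sum fun β _ => ?_
        gcongr
        refine le_of_eq_of_le (lintegral_congr_ae ?_) (hC β)
        filter_upwards [ae_cond_mem (hm (measurableSet_singleton β))] with D hD
        rw [show labels k D = β from hD]
    _ = C := by
        rw [← Finset.sum_mul, sum_measure_preimage_singleton _
          fun β _ => hm (measurableSet_singleton β)]
        simp

/-- Summing, over all indices, class-dependent terms that carry the inverse class sizes. -/
lemma sum_inv_card_mul (β : Fin n → Bool) (F : Bool → Fin n → ℝ) :
    ∑ i, ((Finset.univ.filter fun j => β j = β i).card : ℝ)⁻¹ * F (β i) i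
      = ∑ b, ((Finset.univ.filter fun j => β j = b).card : ℝ)⁻¹
        * ∑ i ∈ Finset.univ.filter fun j => β j = b, F b i := by
  rw [← Finset.sum_fiberwise Finset.univ β]
  refine Finset.sum_congr rfl fun b _ => ?_
  rw [Finset.mul_sum]
  refine Finset.sum_congr rfl fun i hi => ?_
  rw [(Finset.mem_filter.1 hi).2]

variable {H : Type*} [NormedAddCommGroup H] [InnerProductSpace ℝ H] [CompleteSpace H]

lemma sum_inv_card_mul_const {β : Fin n → Bool}
    (hβ : ∀ b, 0 < (Finset.univ.filter fun j => β j = b).card) (h : Bool → ℝ) :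
    ∑ i, ((Finset.univ.filter fun j => β j = β i).card : ℝ)⁻¹ * h (β i) = ∑ b, h b := by
  rw [sum_inv_card_mul β fun b _ => h b]
  refine Finset.sum_congr rfl fun b _ => ?_
  have : ((Finset.univ.filter fun j => β j = b).card : ℝ) ≠ 0 := by exact_mod_cast (hβ b).ne'
  rw [Finset.sum_const, nsmul_eq_mul, inv_mul_cancel_left₀ this]

/-- The deviation bound for one label, conditionally on its values. The loss of an index is
weighted by the inverse size of its class, so the empirical risk is a sum over all indices. -/
lemma exists_deviation_given_labels (P : Measure (Example X K)) [IsProbabilityMeasure P] {k : Fin K}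
    (hP : ∀ b, P {z | z.2 k = b} ≠ 0) {Φ : X → H} {r : ℝ} (hr : ∀ x, ‖Φ x‖ ≤ r)
    (hΦ : Measurable fun p : X × X => (inner ℝ (Φ p.1) (Φ p.2) : ℝ))
    {φ : Bool → ℝ → ℝ} {ρ : Bool → ℝ≥0} (hφ : ∀ b, LipschitzWith (ρ b) (φ b)) {B : ℝ} (hB : 0 < B)
    (hφB : ∀ b (u : Metric.closedBall (0 : H) 1) x, φ b (inner ℝ (u : H) (Φ x)) ∈ Set.Icc 0 B)
    {β : Fin n → Bool} {m : ℝ} (hm : 0 < m)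
    (hmβ : ∀ b, m ≤ (Finset.univ.filter fun j => β j = b).card) :
    ∃ Z : Dataset X K n → ℝ, Measurable Z ∧
      ∫⁻ D, ENNReal.ofReal (Real.exp (Z D ^ 2)) ∂((Measure.pi fun _ : Fin n => P)[|labels k ← β])
        ≤ 2 ∧
      ∀ D, labels k D = β → ∀ u : Metric.closedBall (0 : H) 1,
        ∑ b, ∫ y, φ b (inner ℝ (u : H) (Φ y)) ∂(classLaw P k b)
          ≤ ∑ b, ((classIdx D k b).card : ℝ)⁻¹
              * ∑ i ∈ classIdx D k b, φ b (inner ℝ (u : H) (Φ (D i).1))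
            + 2 * (r * (ρ true + ρ false) / √m) + √18 * B / √m * Z D := by
  set N : Bool → ℝ := fun b => ((Finset.univ.filter fun j => β j = b).card : ℝ)
  have hN0 : ∀ b, 0 < N b := fun b => hm.trans_le (hmβ b)
  have hNc : ∀ b, 0 < (Finset.univ.filter fun j => β j = b).card := fun b =>
    Nat.cast_pos.1 (hN0 b)
  have := fun b => isProbabilityMeasure_classLaw P (hP b)
  have hr0 : 0 ≤ r := by
    obtain ⟨x⟩ := (classLaw P k true).nonempty_of_neZero
    exact (norm_nonneg _).trans (hr x)
  obtain ⟨G, hGm, hGs, hG⟩ := exists_hasSubgaussianMGF_uniform_deviation (n := n)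
    (fun i => classLaw P k (β i)) (Φ := Φ) hr hΦ (ψ := fun i z => (N (β i))⁻¹ * φ (β i) z)
    (L := fun i => (N (β i))⁻¹.toNNReal * ρ (β i)) (c := fun i => (N (β i))⁻¹ * B)
    (fun i => by
      refine LipschitzWith.of_dist_le_mul fun s t => ?_
      have h := (hφ (β i)).dist_le_mul s t
      have hi : 0 ≤ (N (β i))⁻¹ := (inv_pos.2 (hN0 _)).le
      rw [NNReal.coe_mul, Real.coe_toNNReal _ hi, Real.dist_eq, ← mul_sub, abs_mul,
        abs_of_nonneg hi, mul_assoc]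
      exact mul_le_mul_of_nonneg_left h hi)
    (fun i u x => by
      have h := hφB (β i) u x
      have hi : 0 ≤ (N (β i))⁻¹ := (inv_pos.2 (hN0 _)).le
      exact ⟨mul_nonneg hi h.1, mul_le_mul_of_nonneg_left h.2 hi⟩)
  have hNm : ∀ b, (N b)⁻¹ ≤ m⁻¹ := fun b => inv_anti₀ hm (hmβ b)
  have hvar : ∑ i, ((N (β i))⁻¹ * B) ^ 2 ≤ 2 * B ^ 2 / m := by
    have h1 : ∀ i, ((N (β i))⁻¹ * B) ^ 2 = (N (β i))⁻¹ * ((N (β i))⁻¹ * B ^ 2) := fun i => by ring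
    simp only [h1]
    rw [sum_inv_card_mul_const hNc fun b => (N b)⁻¹ * B ^ 2, Fintype.sum_bool]
    have ht := mul_le_mul_of_nonneg_right (hNm true) (sq_nonneg B)
    have hf := mul_le_mul_of_nonneg_right (hNm false) (sq_nonneg B)
    rw [div_eq_mul_inv]
    linarith
  have hcomp : √(∑ i, (((N (β i))⁻¹.toNNReal * ρ (β i) : ℝ≥0) * r) ^ 2)
      ≤ r * (ρ true + ρ false) / √m := by
    have h1 : ∀ i, (((N (β i))⁻¹.toNNReal * ρ (β i) : ℝ≥0) * r) ^ 2
        = (N (β i))⁻¹ * ((N (β i))⁻¹ * (ρ (β i) * r) ^ 2) := fun i => by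
      rw [NNReal.coe_mul, Real.coe_toNNReal _ (inv_pos.2 (hN0 _)).le]
      ring
    simp only [h1]
    rw [sum_inv_card_mul_const hNc fun b => (N b)⁻¹ * (ρ b * r) ^ 2, Fintype.sum_bool]
    refine Real.sqrt_le_iff.2 ⟨by positivity, ?_⟩
    rw [div_pow, Real.sq_sqrt hm.le, div_eq_mul_inv]
    have ht := mul_le_mul_of_nonneg_right (hNm true) (sq_nonneg (ρ true * r))
    have hf := mul_le_mul_of_nonneg_right (hNm false) (sq_nonneg (ρ false * r))
    have hx : 0 ≤ m⁻¹ * (r ^ 2 * (ρ true * ρ false)) := by positivity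
    nlinarith
  have hs18 : 0 < √(18 : ℝ) := by positivity
  have hsm : 0 < √m := by positivity
  -- `Z` rescales the fluctuation so that its sub-Gaussian variance proxy is at most `1 / 36`.
  refine ⟨fun D => √m / (√18 * B) * G fun i => (D i).1, ?_, ?_, ?_⟩
  · have h : Measurable fun (D : Dataset X K n) i => (D i).1 := by fun_prop
    exact (hGm.comp h).const_mul _
  · have hmp := measurePreserving_instances (n := n) P hP β
    have hsq : ∀ x, (√m / (√18 * B) * G x) ^ 2 = m / (18 * B ^ 2) * G x ^ 2 := fun x => by
      rw [mul_pow, div_pow, mul_pow, Real.sq_sqrt hm.le, Real.sq_sqrt (by norm_num)]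
    simp only [hsq]
    have hpush := lintegral_map (μ := (Measure.pi fun _ : Fin n => P)[|labels k ← β])
      (f := fun x => ENNReal.ofReal (Real.exp (m / (18 * B ^ 2) * G x ^ 2))) (by fun_prop)
      hmp.measurable
    rw [hmp.map_eq] at hpush
    rw [← hpush]
    refine lintegral_exp_mul_sq_le_two hGm hGs (by positivity) ?_
    have hvar0 : 0 ≤ (∑ i, ((N (β i))⁻¹ * B) ^ 2) / 4 :=
      div_nonneg (Finset.sum_nonneg fun i _ => sq_nonneg _) (by norm_num)
    rw [Real.coe_toNNReal _ hvar0]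
    calc m / (18 * B ^ 2) * ((∑ i, ((N (β i))⁻¹ * B) ^ 2) / 4)
        ≤ m / (18 * B ^ 2) * (2 * B ^ 2 / m / 4) := by gcongr
      _ ≤ 3 / 8 := by field_simp; norm_num
  · rintro D rfl u
    have h := hG (fun i => (D i).1) u
    have hleft : ∑ i, ∫ y, (N (labels k D i))⁻¹ * φ (labels k D i) (inner ℝ (u : H) (Φ y))
        ∂(classLaw P k (labels k D i))
        = ∑ b, ∫ y, φ b (inner ℝ (u : H) (Φ y)) ∂(classLaw P k b) := by
      simp only [integral_const_mul]
      exact sum_inv_card_mul_const hNc fun b => ∫ y, φ b (inner ℝ (u : H) (Φ y)) ∂(classLaw P k b)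
    have hright : ∑ i, (N (labels k D i))⁻¹ * φ (labels k D i) (inner ℝ (u : H) (Φ (D i).1))
        = ∑ b, ((classIdx D k b).card : ℝ)⁻¹
            * ∑ i ∈ classIdx D k b, φ b (inner ℝ (u : H) (Φ (D i).1)) :=
      sum_inv_card_mul (labels k D) fun b i => φ b (inner ℝ (u : H) (Φ (D i).1))
    rw [hleft, hright] at h
    have hZ : √18 * B / √m * (√m / (√18 * B) * G fun i => (D i).1) = G fun i => (D i).1 := by
      field_simp
    dsimp only
    rw [hZ]
    linarith

/-- The deviation bound for one label. The variable `Z` has the same square-exponential moment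
whatever the class sizes are, although the bound itself depends on them. -/
lemma exists_deviation_of_label (n : ℕ) (P : Measure (Example X K)) [IsProbabilityMeasure P]
    {k : Fin K} (hP : ∀ b, P {z | z.2 k = b} ≠ 0) {Φ : X → H} {r : ℝ} (hr : ∀ x, ‖Φ x‖ ≤ r)
    (hΦ : Measurable fun p : X × X => (inner ℝ (Φ p.1) (Φ p.2) : ℝ))
    {φ : Bool → ℝ → ℝ} {ρ : Bool → ℝ≥0} (hφ : ∀ b, LipschitzWith (ρ b) (φ b)) {B : ℝ} (hB : 0 < B)
    (hφB : ∀ b (u : Metric.closedBall (0 : H) 1) x, φ b (inner ℝ (u : H) (Φ x)) ∈ Set.Icc 0 B) :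
    ∃ Z : Dataset X K n → ℝ, Measurable Z ∧
      ∫⁻ D, ENNReal.ofReal (Real.exp (Z D ^ 2)) ∂(Measure.pi fun _ : Fin n => P) ≤ 2 ∧
      ∀ D (m : ℝ), 0 < m → m = min ((classIdx D k true).card : ℝ) (classIdx D k false).card →
        ∀ u : Metric.closedBall (0 : H) 1,
        ∑ b, ∫ y, φ b (inner ℝ (u : H) (Φ y)) ∂(classLaw P k b)
          ≤ ∑ b, ((classIdx D k b).card : ℝ)⁻¹
              * ∑ i ∈ classIdx D k b, φ b (inner ℝ (u : H) (Φ (D i).1))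
            + 2 * (r * (ρ true + ρ false) / √m) + √18 * B / √m * Z D := by
  let m : (Fin n → Bool) → ℝ := fun β => min
    ((Finset.univ.filter fun j => β j = true).card : ℝ)
    (Finset.univ.filter fun j => β j = false).card
  have key : ∀ β : Fin n → Bool, ∃ Z : Dataset X K n → ℝ, Measurable Z ∧
      ∫⁻ D, ENNReal.ofReal (Real.exp (Z D ^ 2)) ∂((Measure.pi fun _ : Fin n => P)[|labels k ← β])
        ≤ 2 ∧
      (0 < m β → ∀ D, labels k D = β → ∀ u : Metric.closedBall (0 : H) 1,
        ∑ b, ∫ y, φ b (inner ℝ (u : H) (Φ y)) ∂(classLaw P k b)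
          ≤ ∑ b, ((classIdx D k b).card : ℝ)⁻¹
              * ∑ i ∈ classIdx D k b, φ b (inner ℝ (u : H) (Φ (D i).1))
            + 2 * (r * (ρ true + ρ false) / √(m β)) + √18 * B / √(m β) * Z D) := by
    intro β
    by_cases hm : 0 < m β
    · obtain ⟨Z, hZm, hZ2, hZ⟩ := exists_deviation_given_labels P hP hr hΦ hφ hB hφB hm
        (β := β) fun b => by cases b <;> simp [m]
      exact ⟨Z, hZm, hZ2, fun _ => hZ⟩
    -- If a class is empty, nothing is claimed and `Z = 0` will do.
    · refine ⟨fun _ => 0, measurable_const, ?_, fun h => absurd h hm⟩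
      simp only [ne_eq, OfNat.ofNat_ne_zero, not_false_eq_true, zero_pow, Real.exp_zero,
        ENNReal.ofReal_one, lintegral_one]
      exact prob_le_one.trans one_le_two
  choose Z hZm hZ2 hZ using key
  refine ⟨fun D => Z (labels k D) D, ?_, ?_, ?_⟩
  · have h : Measurable fun p : (Fin n → Bool) × Dataset X K n => Z p.1 p.2 :=
      measurable_from_prod_countable_right hZm
    exact h.comp ((measurable_labels k).prodMk measurable_id)
  · exact lintegral_labels_le P k (F := fun β D => ENNReal.ofReal (Real.exp (Z β D ^ 2))) hZ2
  · rintro D _ hm rfl u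
    exact hZ (labels k D) hm D rfl u

end Label

/-! ### Risks -/

lemma hinge_nonneg (z : ℝ) : 0 ≤ hinge z := le_max_left _ _

lemma continuous_hinge : Continuous hinge := by unfold hinge; fun_prop

/-- The surrogate loss dominates the pairwise 0/1 loss. -/
lemma loss01_le_lossRM {X : Type*} {Δp Δm : ℝ} (hp : 0 < Δp) (hm : 0 < Δm) (xp xm : X)
    (g : X → ℝ) : loss01 xp xm g ≤ lossRM Δp Δm xp xm g := by
  unfold loss01 lossRM
  split_ifs with h
  · have h1 : 1 - (g xp - Δp) ≤ hinge (g xp - Δp) := le_max_right _ _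
    have h2 : 1 - (-g xm - Δm) ≤ hinge (-g xm - Δm) := le_max_right _ _
    linarith
  · exact add_nonneg (hinge_nonneg _) (hinge_nonneg _)

section Risk

variable {X : Type*} [MeasurableSpace X] {K n : ℕ}

/-- The part of the surrogate loss that is incurred on an instance of the class `b`, as a function
of its score. -/
noncomputable def classLoss (Δp Δm : ℝ) (b : Bool) (z : ℝ) : ℝ :=
  if b then hinge (z - Δp) else hinge (-z - Δm)

lemma lossRM_eq {X : Type*} (Δp Δm : ℝ) (xp xm : X) (g : X → ℝ) :
    lossRM Δp Δm xp xm g = classLoss Δp Δm true (g xp) + classLoss Δp Δm false (g xm) := by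
  simp [lossRM, classLoss]

lemma continuous_classLoss (Δp Δm : ℝ) (b : Bool) : Continuous (classLoss Δp Δm b) := by
  cases b
  · exact continuous_hinge.comp (continuous_neg.sub continuous_const)
  · exact continuous_hinge.comp (continuous_id.sub continuous_const)

lemma classLoss_nonneg (Δp Δm : ℝ) (b : Bool) (z : ℝ) : 0 ≤ classLoss Δp Δm b z := by
  cases b <;> simp [classLoss, hinge_nonneg]

lemma integrable_classLoss {ν : Measure X} [IsFiniteMeasure ν] {Δp Δm B : ℝ} {b : Bool} {g : X → ℝ}
    (hg : Measurable g) (hB : ∀ x, classLoss Δp Δm b (g x) ≤ B) :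
    Integrable (fun x => classLoss Δp Δm b (g x)) ν :=
  Integrable.of_bound ((continuous_classLoss Δp Δm b).measurable.comp hg).aestronglyMeasurable B
    (Filter.Eventually.of_forall fun x => by
      rw [Real.norm_of_nonneg (classLoss_nonneg _ _ _ _)]; exact hB x)

lemma integrable_lossRM {ν ν' : Measure X} [IsFiniteMeasure ν] [IsFiniteMeasure ν'] {Δp Δm B : ℝ}
    {g : X → ℝ} (hg : Measurable g) (hB : ∀ b x, classLoss Δp Δm b (g x) ≤ B) :
    Integrable (fun z => lossRM Δp Δm z.1 z.2 g) (ν.prod ν') := by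
  simp only [lossRM_eq]
  exact ((integrable_classLoss hg (hB true)).comp_fst ν').add
    ((integrable_classLoss hg (hB false)).comp_snd ν)

/-- The surrogate loss is a sum of two losses of one instance each, so no pair of instances is
left in its expectation. -/
lemma integral_lossRM {ν ν' : Measure X} [IsProbabilityMeasure ν] [IsProbabilityMeasure ν']
    {Δp Δm B : ℝ} {g : X → ℝ} (hg : Measurable g) (hB : ∀ b x, classLoss Δp Δm b (g x) ≤ B) :
    ∫ z, lossRM Δp Δm z.1 z.2 g ∂(ν.prod ν')
      = ∫ x, classLoss Δp Δm true (g x) ∂ν + ∫ x, classLoss Δp Δm false (g x) ∂ν' := by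
  simp only [lossRM_eq]
  rw [integral_add ((integrable_classLoss hg (hB true)).comp_fst ν')
    ((integrable_classLoss hg (hB false)).comp_snd ν),
    integral_fun_fst (fun x => classLoss Δp Δm true (g x)),
    integral_fun_snd (fun x => classLoss Δp Δm false (g x))]
  simp

lemma sum_product_lossRM {X : Type*} {s t : Finset (Fin n)} (hs : s.Nonempty) (ht : t.Nonempty)
    (Δp Δm : ℝ) (x : Fin n → X) (g : X → ℝ) :
    (1 / ((s.card : ℝ) * t.card)) * ∑ pq ∈ s ×ˢ t, lossRM Δp Δm (x pq.1) (x pq.2) g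
      = (s.card : ℝ)⁻¹ * ∑ i ∈ s, classLoss Δp Δm true (g (x i))
        + (t.card : ℝ)⁻¹ * ∑ i ∈ t, classLoss Δp Δm false (g (x i)) := by
  have hs0 : (s.card : ℝ) ≠ 0 := Nat.cast_ne_zero.2 hs.card_pos.ne'
  have ht0 : (t.card : ℝ) ≠ 0 := Nat.cast_ne_zero.2 ht.card_pos.ne'
  simp only [lossRM_eq, Finset.sum_add_distrib]
  rw [Finset.sum_product, Finset.sum_product_right]
  simp only [Finset.sum_const, nsmul_eq_mul, ← Finset.mul_sum]
  field_simp

lemma risk01_le_riskRM (P : Measure (Example X K)) [IsProbabilityMeasure P]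
    {Δp Δm : Fin K → ℝ} (hp : ∀ k, 0 < Δp k) (hm : ∀ k, 0 < Δm k) {f : X → Fin K → ℝ}
    (hf : ∀ k, Measurable fun x => f x k) {B : ℝ}
    (hB : ∀ k b x, classLoss (Δp k) (Δm k) b (f x k) ≤ B) :
    risk01 P f ≤ riskRM P Δp Δm f := by
  unfold risk01 riskRM posLaw negLaw
  refine mul_le_mul_of_nonneg_left (Finset.sum_le_sum fun k _ => ?_) (by positivity)
  refine integral_mono_of_nonneg (Filter.Eventually.of_forall fun z => ?_) ?_
    (Filter.Eventually.of_forall fun z => loss01_le_lossRM (hp k) (hm k) _ _ _)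
  · simp only [loss01, Pi.zero_apply]
    split_ifs <;> norm_num
  · exact integrable_lossRM (hf k) (hB k)

end Risk

/-! ### The learning guarantee -/

section Averaging

variable {K : ℕ}

/-- Jensen's inequality turns a bound on an average of exponentials into one on the average of the
exponents. -/
lemma average_le_log_of_sum_exp_lt (hK : 0 < K) {a : Fin K → ℝ} {t : ℝ}
    (h : ∑ k, Real.exp (a k) < K * t) : (1 / (K : ℝ)) * ∑ k, a k ≤ Real.log t := by
  have hK' : (0 : ℝ) < K := Nat.cast_pos.2 hK
  have hJ := convexOn_exp.map_sum_le (t := Finset.univ) (w := fun _ : Fin K => 1 / (K : ℝ)) (p := a)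
    (fun _ _ => by positivity) (by simp [hK'.ne']) fun _ _ => Set.mem_univ _
  simp only [smul_eq_mul, ← Finset.mul_sum] at hJ
  have hlt : Real.exp ((1 / (K : ℝ)) * ∑ k, a k) < t := by
    refine hJ.trans_lt ?_
    rw [one_div, inv_mul_lt_iff₀ hK']
    exact h
  exact ((Real.lt_log_iff_exp_lt ((Real.exp_pos _).trans hlt)).2 hlt).le

/-- The Cauchy–Schwarz step that separates the class sizes `m k` from the fluctuations `Z k`. -/
lemma average_div_sqrt_mul_le (hK : 0 < K) {N : ℝ} (hN : 0 < N) {m Z : Fin K → ℝ}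
    (hm : ∀ k, 0 < m k) {B l : ℝ} (hB : 0 ≤ B) (hZ : (1 / (K : ℝ)) * ∑ k, Z k ^ 2 ≤ l) :
    (1 / (K : ℝ)) * ∑ k, √18 * B / √(m k) * Z k
      ≤ 6 * B * √(l / (2 * N)) * √((1 / (K : ℝ)) * ∑ k, 1 / (m k / N)) := by
  have hK' : (0 : ℝ) < K := Nat.cast_pos.2 hK
  set S := (1 / (K : ℝ)) * ∑ k, 1 / m k with hS
  have hS0 : 0 ≤ S := mul_nonneg (by positivity)
    (Finset.sum_nonneg fun k _ => (one_div_pos.2 (hm k)).le)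
  have hl : 0 ≤ l :=
    (mul_nonneg (by positivity) (Finset.sum_nonneg fun k _ => sq_nonneg _)).trans hZ
  have hCS := Real.sum_mul_le_sqrt_mul_sqrt Finset.univ (fun k => 1 / √(m k)) Z
  have hsq : ∀ k, (1 / √(m k)) ^ 2 = 1 / m k := fun k => by
    rw [div_pow, one_pow, Real.sq_sqrt (hm k).le]
  simp only [hsq] at hCS
  have h1 : (1 / (K : ℝ)) * ∑ k, 1 / √(m k) * Z k ≤ √S * √l := by
    calc _ ≤ (1 / (K : ℝ)) * (√(∑ k, 1 / m k) * √(∑ k, Z k ^ 2)) := by gcongr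
      _ = √S * √((1 / (K : ℝ)) * ∑ k, Z k ^ 2) := by
        rw [hS, Real.sqrt_mul (by positivity), Real.sqrt_mul (by positivity)]
        have : √(1 / (K : ℝ)) * √(1 / (K : ℝ)) = 1 / K := Real.mul_self_sqrt (by positivity)
        linear_combination -(√(∑ k, 1 / m k) * √(∑ k, Z k ^ 2)) * this
      _ ≤ _ := by gcongr
  have h2 : (1 / (K : ℝ)) * ∑ k, 1 / (m k / N) = N * S := by
    have h : ∀ k, 1 / (m k / N) = N * (1 / m k) := fun k => by rw [one_div_div, mul_one_div]
    simp only [h, ← Finset.mul_sum]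
    rw [hS, mul_left_comm]
  have h3 : √(l / (2 * N)) * √(N * S) = √(1 / 2) * (√S * √l) := by
    rw [← Real.sqrt_mul (by positivity), ← Real.sqrt_mul hS0, ← Real.sqrt_mul (by norm_num)]
    congr 1
    field_simp
  have h4 : √(18 : ℝ) = 6 * √(1 / 2) := by
    rw [show (18 : ℝ) = 6 ^ 2 * (1 / 2) by norm_num, Real.sqrt_mul (by norm_num),
      Real.sqrt_sq (by norm_num)]
  calc (1 / (K : ℝ)) * ∑ k, √18 * B / √(m k) * Z k
      = √18 * B * ((1 / (K : ℝ)) * ∑ k, 1 / √(m k) * Z k) := by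
        have h : ∀ k, √18 * B / √(m k) * Z k = √18 * B * (1 / √(m k) * Z k) := fun k => by ring
        simp only [h, ← Finset.mul_sum]
        rw [mul_left_comm]
    _ ≤ √18 * B * (√S * √l) := by gcongr
    _ = _ := by rw [h2, mul_assoc (6 * B), h3, h4]; ring

/-- If variables `Z k`, possibly dependent, have square-exponential moments at most `2`, then the
average of their squares is at most `log (2 / δ)` with probability at least `1 - δ`. -/
lemma exists_event_average_sq_le {Ω : Type*} [MeasurableSpace Ω] (Q : Measure Ω)
    [IsProbabilityMeasure Q] (hK : 0 < K) {Z : Fin K → Ω → ℝ} (hZm : ∀ k, Measurable (Z k))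
    (hZ : ∀ k, ∫⁻ ω, ENNReal.ofReal (Real.exp (Z k ω ^ 2)) ∂Q ≤ 2) {δ : ℝ} (hδ : 0 < δ) :
    ∃ E : Set Ω, MeasurableSet E ∧ ENNReal.ofReal (1 - δ) ≤ Q E ∧
      ∀ ω ∈ E, (1 / (K : ℝ)) * ∑ k, Z k ω ^ 2 ≤ Real.log (2 / δ) := by
  have hK' : (0 : ℝ) < K := Nat.cast_pos.2 hK
  have hWm : Measurable fun ω => ∑ k, Real.exp (Z k ω ^ 2) := by fun_prop
  have hEm : MeasurableSet {ω | ∑ k, Real.exp (Z k ω ^ 2) < K * (2 / δ)} :=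
    measurableSet_lt hWm measurable_const
  refine ⟨_, hEm, ?_, fun ω hω => average_le_log_of_sum_exp_lt hK hω⟩
  have hpos : (0 : ℝ) < K * (2 / δ) := by positivity
  have hint : ∫⁻ ω, ENNReal.ofReal (∑ k, Real.exp (Z k ω ^ 2)) ∂Q ≤ ENNReal.ofReal (K * 2) := by
    simp only [ENNReal.ofReal_sum_of_nonneg fun k _ => (Real.exp_pos _).le]
    rw [lintegral_finsetSum _ fun k _ => by fun_prop]
    refine (Finset.sum_le_sum fun k _ => hZ k).trans (le_of_eq ?_)
    rw [ENNReal.ofReal_mul hK'.le]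
    simp
  have hbad : Q {ω | ∑ k, Real.exp (Z k ω ^ 2) < K * (2 / δ)}ᶜ ≤ ENNReal.ofReal δ := by
    have hsub : {ω | ∑ k, Real.exp (Z k ω ^ 2) < K * (2 / δ)}ᶜ
        = {ω | ENNReal.ofReal (K * (2 / δ)) ≤ ENNReal.ofReal (∑ k, Real.exp (Z k ω ^ 2))} := by
      ext ω
      simp only [Set.mem_compl_iff, Set.mem_ofPred_eq, not_lt]
      rw [ENNReal.ofReal_le_ofReal_iff (Finset.sum_nonneg fun k _ => (Real.exp_pos _).le)]
    rw [hsub]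
    refine (meas_ge_le_lintegral_div (by fun_prop) (ENNReal.ofReal_pos.2 hpos).ne'
      ENNReal.ofReal_ne_top).trans ?_
    refine (ENNReal.div_le_div_right hint _).trans (le_of_eq ?_)
    rw [← ENNReal.ofReal_div_of_pos hpos]
    congr 1
    field_simp
  have hone := prob_compl_eq_one_sub (μ := Q) hEm.compl
  rw [compl_compl] at hone
  rw [hone, ENNReal.ofReal_sub _ hδ.le, ENNReal.ofReal_one]
  exact tsub_le_tsub_left hbad _

end Averaging

end MacroAUC

theorem mainTheorem2
    {X : Type*} [MeasurableSpace X]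
    {H : Type*} [NormedAddCommGroup H] [InnerProductSpace ℝ H] [CompleteSpace H]
    (K n : ℕ)
    -- the distribution of the examples
    (P : Measure (MacroAUC.Example X K)) [IsProbabilityMeasure P]
    (hPpos : ∀ k, P {z | z.2 k = true} ≠ 0) (hPneg : ∀ k, P {z | z.2 k = false} ≠ 0)
    -- the kernel, with feature map `Φ`
    (κ : X → X → ℝ) (hκ_meas : Measurable (Function.uncurry κ))
    (Φ : X → H) (hΦ : ∀ x x', inner ℝ (Φ x) (Φ x') = κ x x')
    (r : ℝ) (hr : 0 < r) (hκ_bdd : ∀ x, κ x x ≤ r ^ 2)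
    (Λ : ℝ)
    -- the margins, the bound on the base loss and the Lipschitz constants
    (Δp Δm : Fin K → ℝ) (hΔp : ∀ k, 0 < Δp k) (hΔm : ∀ k, 0 < Δm k)
    (B : ℝ)
    (hB : ∀ f ∈ MacroAUC.kernelClass K Φ Λ, ∀ x k,
      MacroAUC.hinge (f x k - Δp k) ≤ B ∧ MacroAUC.hinge (-f x k - Δm k) ≤ B)
    (ρp ρm : Fin K → ℝ≥0)
    (hρp : ∀ k, LipschitzWith (ρp k) fun z => MacroAUC.hinge (z - Δp k))
    (hρm : ∀ k, LipschitzWith (ρm k) fun z => MacroAUC.hinge (z - Δm k))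
    (δ : ℝ) (hδ : 0 < δ) :
    (∀ f ∈ MacroAUC.kernelClass K Φ Λ,
      MacroAUC.risk01 P f ≤ MacroAUC.riskRM P Δp Δm f) ∧
    ∃ E : Set (MacroAUC.Dataset X K n), MeasurableSet E ∧
      ENNReal.ofReal (1 - δ) ≤ Measure.pi (fun _ : Fin n => P) E ∧
      ∀ D ∈ E, (∀ k, (MacroAUC.posIdx D k).Nonempty ∧ (MacroAUC.negIdx D k).Nonempty) →
        ∀ f ∈ MacroAUC.kernelClass K Φ Λ,
          MacroAUC.riskRM P Δp Δm f ≤ MacroAUC.empRiskRM D Δp Δm f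
            + (4 * Λ * r / √(n : ℝ)) *
              ((1 / (K : ℝ)) * ∑ k, √(1 / MacroAUC.imbalance D k) * ((ρp k : ℝ) + ρm k))
            + 6 * B * √(Real.log (2 / δ) / (2 * n)) *
              √((1 / (K : ℝ)) * ∑ k, 1 / MacroAUC.imbalance D k) := by
  open MacroAUC in
  have hΦm : Measurable fun p : X × X => (inner ℝ (Φ p.1) (Φ p.2) : ℝ) := by
    simp only [hΦ]; exact hκ_meas
  have hclass : ∀ f ∈ kernelClass K Φ Λ, ∀ k b x, classLoss (Δp k) (Δm k) b (f x k) ≤ B := by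
    intro f hf k b x
    cases b
    · simpa [classLoss] using (hB f hf x k).2
    · simpa [classLoss] using (hB f hf x k).1
  have hfm : ∀ f ∈ kernelClass K Φ Λ, ∀ k, Measurable fun x => f x k := by
    rintro f ⟨w, -, hfw⟩ k
    simp only [hfw]
    exact measurable_inner_feature hΦm (w k)
  refine ⟨fun f hf => risk01_le_riskRM P hΔp hΔm (hfm f hf) (hclass f hf), ?_⟩
  -- Without labels all risks are empty sums, and for `Λ < 0` the hypothesis class is empty.
  rcases Nat.eq_zero_or_pos K with rfl | hK
  · exact ⟨Set.univ, MeasurableSet.univ, by simpa using hδ.le, fun D _ _ f _ => by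
      simp [riskRM, empRiskRM]⟩
  rcases lt_or_ge Λ 0 with hΛ | hΛ
  · refine ⟨Set.univ, MeasurableSet.univ, by simpa using hδ.le, ?_⟩
    rintro D - - f ⟨w, hw, -⟩
    exact absurd ((norm_nonneg _).trans (hw ⟨0, hK⟩)) (not_le.2 hΛ)
  -- The ball of radius `Λ` is the unit ball for the feature map `Λ • Φ`.
  have hP : ∀ k b, P {z | z.2 k = b} ≠ 0 := fun k b => by
    cases b
    exacts [hPneg k, hPpos k]
  have hr' : ∀ x, ‖Λ • Φ x‖ ≤ Λ * r := fun x => by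
    rw [norm_smul, Real.norm_of_nonneg hΛ]
    refine mul_le_mul_of_nonneg_left (le_of_sq_le_sq ?_ hr.le) hΛ
    rw [← real_inner_self_eq_norm_sq, hΦ]
    exact hκ_bdd x
  have hΦ' : Measurable fun p : X × X => (inner ℝ (Λ • Φ p.1) (Λ • Φ p.2) : ℝ) := by
    simp only [inner_smul_left, inner_smul_right]
    fun_prop
  have hmem : ∀ u : Metric.closedBall (0 : H) 1,
      (fun x (_ : Fin K) => (inner ℝ (u : H) (Λ • Φ x) : ℝ)) ∈ kernelClass K Φ Λ := by
    intro u
    refine ⟨fun _ => Λ • (u : H), fun _ => ?_, fun x _ => ?_⟩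
    · rw [norm_smul, Real.norm_of_nonneg hΛ]
      exact mul_le_of_le_one_right hΛ (mem_closedBall_zero_iff.1 u.2)
    · simp [inner_smul_left, inner_smul_right]
  -- The zero function belongs to the class, and its hinge loss is at least `1`.
  have hB0 : 0 < B := by
    obtain ⟨z⟩ := P.nonempty_of_neZero
    have h := (hB _ (hmem ⟨0, by simp⟩) z.1 ⟨0, hK⟩).1
    simp only [inner_zero_left, zero_sub] at h
    have h' : 1 - -Δp ⟨0, hK⟩ ≤ hinge (-Δp ⟨0, hK⟩) := le_max_right _ _
    linarith [hΔp ⟨0, hK⟩]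
  have hlip : ∀ k b, LipschitzWith (if b then ρp k else ρm k) (classLoss (Δp k) (Δm k) b) := by
    intro k b
    cases b
    · have := (hρm k).comp (LipschitzWith.id.neg (f := fun z : ℝ => z))
      rw [mul_one] at this
      exact this
    · exact hρp k
  have hdev := fun k => exists_deviation_of_label n P (hP k) hr' hΦ' (hlip k) hB0
    fun b u x => ⟨classLoss_nonneg _ _ _ _, hclass _ (hmem u) k b x⟩
  choose Z hZm hZ2 hZ using hdev
  obtain ⟨E, hEm, hE, hEZ⟩ :=
    exists_event_average_sq_le (Measure.pi fun _ : Fin n => P) hK hZm hZ2 hδ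
  refine ⟨E, hEm, hE, fun D hD hne f hf => ?_⟩
  have hn : (0 : ℝ) < n := by
    obtain ⟨i, -⟩ := (hne ⟨0, hK⟩).1
    exact Nat.cast_pos.2 i.pos
  set m : Fin K → ℝ := fun k => min ((posIdx D k).card : ℝ) (negIdx D k).card
  have hm0 : ∀ k, 0 < m k := fun k =>
    lt_min (Nat.cast_pos.2 (hne k).1.card_pos) (Nat.cast_pos.2 (hne k).2.card_pos)
  have himb : ∀ k, imbalance D k = m k / n := fun k => rfl
  obtain ⟨w, hw, hfw⟩ := hf
  have hlabel : ∀ k,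
      ∫ z, lossRM (Δp k) (Δm k) z.1 z.2 (fun x => f x k) ∂((posLaw P k).prod (negLaw P k))
        ≤ (1 / (((posIdx D k).card : ℝ) * ((negIdx D k).card : ℝ))) *
            ∑ pq ∈ posIdx D k ×ˢ negIdx D k,
              lossRM (Δp k) (Δm k) (D pq.1).1 (D pq.2).1 (fun x => f x k)
          + (4 * Λ * r / √(n : ℝ)) * (√(1 / imbalance D k) * ((ρp k : ℝ) + ρm k))
          + √18 * B / √(m k) * Z k D := by
    intro k
    obtain ⟨u, hu⟩ : ∃ u : Metric.closedBall (0 : H) 1, w k = Λ • (u : H) := by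
      rcases hΛ.eq_or_lt with rfl | hΛ'
      · exact ⟨⟨0, by simp⟩, by simpa using hw k⟩
      · refine ⟨⟨Λ⁻¹ • w k, ?_⟩, by simp [smul_smul, hΛ'.ne']⟩
        rw [mem_closedBall_zero_iff, norm_smul, norm_inv, Real.norm_of_nonneg hΛ,
          inv_mul_le_one₀ hΛ']
        exact hw k
    have hfu : ∀ x, f x k = inner ℝ (u : H) (Λ • Φ x) := fun x => by
      rw [hfw, hu]
      simp [inner_smul_left, inner_smul_right]
    have := isProbabilityMeasure_classLaw P (hP k true)
    have := isProbabilityMeasure_classLaw P (hP k false)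
    have hbound := hZ k D (m k) (hm0 k) rfl u
    simp only [← hfu, Fintype.sum_bool] at hbound
    rw [sum_product_lossRM (hne k).1 (hne k).2 _ _ (fun i => (D i).1) fun x => f x k]
    have hint : ∫ z, lossRM (Δp k) (Δm k) z.1 z.2 (fun x => f x k)
        ∂((posLaw P k).prod (negLaw P k)) = _ :=
      integral_lossRM (ν := classLaw P k true) (ν' := classLaw P k false)
        (hfm f ⟨w, hw, hfw⟩ k) (hclass f ⟨w, hw, hfw⟩ k)
    have hcplx : 2 * (Λ * r * (ρp k + ρm k) / √(m k))
        ≤ (4 * Λ * r / √(n : ℝ)) * (√(1 / imbalance D k) * ((ρp k : ℝ) + ρm k)) := by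
      rw [himb, one_div_div, Real.sqrt_div hn.le]
      have hsn : 0 < √(n : ℝ) := Real.sqrt_pos.2 hn
      have heq : (4 * Λ * r / √(n : ℝ)) * (√(n : ℝ) / √(m k) * ((ρp k : ℝ) + ρm k))
          = 4 * (Λ * r * (ρp k + ρm k) / √(m k)) := by field_simp
      rw [heq]
      have : 0 ≤ Λ * r * (ρp k + ρm k) / √(m k) := by positivity
      linarith
    rw [hint]
    simp only [if_true, Bool.false_eq_true, if_false] at hbound
    refine hbound.trans ?_
    exact add_le_add_left (add_le_add_right hcplx _) _
  have hfluct := average_div_sqrt_mul_le hK hn hm0 hB0.le (hEZ D hD)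
  simp only [← himb] at hfluct
  have hK0 : (0 : ℝ) ≤ 1 / K := by positivity
  have hsum := mul_le_mul_of_nonneg_left (Finset.sum_le_sum fun k (_ : k ∈ Finset.univ) => hlabel k)
    hK0
  rw [Finset.sum_add_distrib, Finset.sum_add_distrib, mul_add, mul_add, ← Finset.mul_sum,
    mul_left_comm (1 / (K : ℝ)) (4 * Λ * r / √(n : ℝ))] at hsum
  exact hsum.trans (add_le_add_right hfluct _)
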